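/- Setting. Let $(\mathcal B_s,\|\cdot\|_s)$ and $(\mathcal B_w,\|\cdot\|_w)$ be complex Banach spaces with a continuous injective embedding $\mathcal B_s\hookrightarrow\mathcal B_w$ that is compact; for an operator $T$ on $\mathcal B_s$ write $\|T\|_{s\to w}$ for its norm as an operator $\mathcal B_s\to\mathcal B_w$. Let $L$ be a bounded operator on $\mathcal B_s$ with a bounded extension to $\mathcal B_w$, and let $a,b,M\in(0,\infty)$ be such that for all $u\in\mathcal B_s$ $$\|Lu\|_s\le a\|u\|_s+b\|u\|_w,\qquad \|Lu\|_w\le M\|u\|_w .$$ Let $\pi_k:\mathcal B_w\to\mathcal B_w$ be finite-rank projections with $\pi_k^2=\pi_k$, $\|\pi_k\|_{w\to w}\le1$, $\operatorname{Ran}\pi_k\subset\mathcal B_s$, $\|\pi_k\|_{s\to s}\le1$ and $\pi_k\pi_{k'}=\pi_k$ for $k'\ge k$. Put $L_k:=\pi_kL\pi_k$ (an operator on $\mathcal B_s$ and on $\mathcal B_w$), and assume that $L_k$ satisfies the same two one-step bounds as $L$ and that there is a sequence $\varepsilon_k\downarrow0$ with $$\|(\mathrm{Id}-\pi_k)L\|_{s\to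 w}+\|L(\mathrm{Id}-\pi_k)\|_{s\to w}\le\varepsilon_k .$$ Put $\delta_k:=\|L-L_k\|_{s\to w}$ and $E_{k,w\to s}:=\sup\{\|u\|_s/\|u\|_w: 0\ne u\in\operatorname{Ran}\pi_k\}$ (with value $0$ if $\operatorname{Ran}\pi_k=0$). Write $\rho(A)$ for the resolvent set, and $\mathcal R_w(z,L_k)$ for the norm of $(z-L_k)^{-1}$ on $\mathcal B_w$ ($+\infty$ if $z$ is in the spectrum of $L_k$ on $\mathcal B_w$). For a bounded domain $U$ whose boundary is piecewise $C^1$, i.e. $\partial U$ is traced out by a finite family of piecewise $C^1$ closed curves that is positively oriented (total winding number $1$ about every point of $U$ and $0$ about every point outside $\overline U$), and an operator $A$ on $\mathcal B_s$ with $\partial U\subset\rho(A)$, let $P_A(U):=\frac1{2\pi i}\int_{\partial U}(z-A)^{-1}\,dz$ be the Riesz projector. Theorem. Suppose $0<a<M$, fix $\mu\in(a,M)$, let $\mathfrak q:=|\log(\mu/M)|/|\log(a/M)|$, and suppose $\delta_kE_{k,w\to s}^{\mathfrak q}\to0$ as $k\to\infty$. (A) Let $U\subset\mathbb C$ be a bounded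 domain with piecewise $C^1$ boundary $\Gamma=\partial U$ such that $\inf_{z\in\Gamma}|z|\ge\mu$ and $\Gamma\subset\rho(L)$. Then there is $k_0$ such that for all $k\ge k_0$: 1. $\Gamma\subset\rho(L_k)$ (on $\mathcal B_s$ and on $\mathcal B_w$), and $\sup_{z\in\Gamma}b\,\delta_k\,\mathcal R_w(z,L_k)<\inf_{z\in\Gamma}(|z|-a)$; 2. $\dim\operatorname{Ran}P_{L_k}(U)=\dim\operatorname{Ran}P_L(U)$ (as cardinals, if infinite); and moreover 3. $\|P_{L_k}(U)-P_L(U)\|_{s\to w}\to0$ as $k\to\infty$. (B) In particular, let $\lambda$ be an eigenvalue of $L$ on $\mathcal B_s$ with $|\lambda|>\mu$, and let $\varepsilon>0$. Then for all sufficiently large $k$ there are an eigenvalue $\nu$ of $L_k$ with $|\nu-\lambda|<\varepsilon$, an eigenvector $v$ of $L_k$ for $\nu$, and an eigenvector $u$ of $L$ for $\lambda$ with $\|u\|_w=1$ and $\|v-u\|_w<\varepsilon$. Moreover, for every eigenvector $u$ of $L$ for $\lambda$ and all sufficiently large $k$ there is a vector $v$ in the sum of the generalized eigenspaces of $L_k$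 on $\mathcal B_s$ for the eigenvalues in the disc $\{\nu:|\nu-\lambda|<\varepsilon\}$ with $\|v-u\|_w<\varepsilon$. -/

import Mathlib

open Filter Topology
open scoped ENNReal

noncomputable section

/-- A closed piecewise `C¹` curve in the plane, parametrised by `[0, 1]`. -/
structure PiecewiseC1Loop where
  toFun : ℝ → ℂ
  continuousOn : ContinuousOn toFun (Set.Icc 0 1)
  closed : toFun 0 = toFun 1
  piecewise : ∃ (n : ℕ) (t : ℕ → ℝ), t 0 = 0 ∧ t n = 1 ∧ (∀ j < n, t j < t (j + 1)) ∧
    ∀ j < n, ContDiffOn ℝ 1 toFun (Set.Icc (t j) (t (j + 1)))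

/-- The set of points on the curve. -/
def PiecewiseC1Loop.trace (γ : PiecewiseC1Loop) : Set ℂ := γ.toFun '' Set.Icc 0 1

/-- The contour integral `∮_γ f(z) dz`. (The derivative of `γ` exists outside a finite set.) -/
def PiecewiseC1Loop.integral {E : Type*} [NormedAddCommGroup E] [NormedSpace ℂ E]
    (γ : PiecewiseC1Loop) (f : ℂ → E) : E :=
  ∫ t in (0 : ℝ)..1, deriv γ.toFun t • f (γ.toFun t)

/-- The contour integral over a cycle, that is, over a finite family of closed curves. -/
def cycleIntegral {E : Type*} [NormedAddCommGroup E] [NormedSpace ℂ E] {n : ℕ}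
    (C : Fin n → PiecewiseC1Loop) (f : ℂ → E) : E :=
  ∑ j, (C j).integral f

/-- The winding number of a cycle about a point off the cycle. -/
def cycleWinding {n : ℕ} (C : Fin n → PiecewiseC1Loop) (c : ℂ) : ℂ :=
  (2 * (Real.pi : ℂ) * Complex.I)⁻¹ * cycleIntegral C (fun z => (z - c)⁻¹)

/-- `U` is a bounded domain and the cycle `C` of piecewise `C¹` closed curves is its positively
oriented boundary: the curves trace out exactly the frontier of `U`, and the cycle winds once
around every point of `U` and not at all around the points outside the closure of `U`.
For a Jordan domain, `C` is one positively oriented Jordan curve; several curves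
occur when `U` is multiply connected. -/
structure IsPiecewiseC1Domain (U : Set ℂ) {n : ℕ} (C : Fin n → PiecewiseC1Loop) : Prop where
  isOpen : IsOpen U
  isConnected : IsConnected U
  isBounded : Bornology.IsBounded U
  frontier_eq : frontier U = ⋃ j, (C j).trace
  winding_inside : ∀ c ∈ U, cycleWinding C c = 1
  winding_outside : ∀ c ∉ closure U, cycleWinding C c = 0

/-- The Riesz projector `(2πi)⁻¹ ∮_{∂U} (z - A)⁻¹ dz`, with `∂U` parametrised by the cycle `C`. -/
def rieszProjector {E : Type*} [NormedAddCommGroup E] [NormedSpace ℂ E]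
    {n : ℕ} (C : Fin n → PiecewiseC1Loop) (A : E →L[ℂ] E) : E →L[ℂ] E :=
  (2 * (Real.pi : ℂ) * Complex.I)⁻¹ • cycleIntegral C (fun z => resolvent A z)

open Classical in
/-- The resolvent norm `‖(z - A)⁻¹‖`, equal to `∞` on the spectrum. -/
def resolventNorm {E : Type*} [NormedAddCommGroup E] [NormedSpace ℂ E]
    (A : E →L[ℂ] E) (z : ℂ) : ℝ≥0∞ :=
  if z ∈ resolventSet ℂ A then ‖resolvent A z‖ₑ else ⊤

/-- The strong–weak setting: a compact embedding `emb` of the strong space `Bs` into the weak space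
`Bw`, an operator with a one-step Doeblin–Fortet–Lasota–Yorke inequality, and a nested Galerkin
hierarchy of finite-rank projections. -/
structure DFLYGalerkin (Bs Bw : Type*) [NormedAddCommGroup Bs] [NormedSpace ℂ Bs]
    [NormedAddCommGroup Bw] [NormedSpace ℂ Bw] where
  /-- the embedding of the strong space into the weak space -/
  emb : Bs →L[ℂ] Bw
  emb_injective : Function.Injective emb
  emb_compact : IsCompactOperator emb
  /-- the operator on the strong space -/
  L : Bs →L[ℂ] Bs
  /-- its bounded extension to the weak space -/
  Lw : Bw →L[ℂ] Bw
  Lw_emb : ∀ u, Lw (emb u) = emb (L u)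
  a : ℝ
  b : ℝ
  M : ℝ
  a_pos : 0 < a
  b_pos : 0 < b
  M_pos : 0 < M
  strong_bound : ∀ u, ‖L u‖ ≤ a * ‖u‖ + b * ‖emb u‖
  weak_bound : ∀ u, ‖emb (L u)‖ ≤ M * ‖emb u‖
  /-- the projections on the weak space -/
  π : ℕ → Bw →L[ℂ] Bw
  /-- their restrictions to the strong space -/
  πs : ℕ → Bs →L[ℂ] Bs
  π_emb : ∀ k u, π k (emb u) = emb (πs k u)
  π_finite : ∀ k, FiniteDimensional ℂ (LinearMap.range (π k : Bw →ₗ[ℂ] Bw))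
  π_range : ∀ k f, π k f ∈ Set.range emb
  π_idem : ∀ k, (π k).comp (π k) = π k
  π_norm : ∀ k, ‖π k‖ ≤ 1
  πs_norm : ∀ k, ‖πs k‖ ≤ 1
  π_nested : ∀ k k', k ≤ k' → (π k).comp (π k') = π k
  ε : ℕ → ℝ
  ε_antitone : Antitone ε
  ε_tendsto : Tendsto ε atTop (𝓝 0)
  /-- `‖(Id - π_k) L‖_{s→w} + ‖L (Id - π_k)‖_{s→w} ≤ ε_k` -/
  mixed_tail : ∀ k,
    ‖emb.comp ((ContinuousLinearMap.id ℂ Bs - πs k).comp L)‖ +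
      ‖emb.comp (L.comp (ContinuousLinearMap.id ℂ Bs - πs k))‖ ≤ ε k
  /-- the discretized operators `L_k = π_k L π_k` satisfy the same one-step bounds -/
  strong_bound_k : ∀ k u, ‖πs k (L (πs k u))‖ ≤ a * ‖u‖ + b * ‖emb u‖
  weak_bound_k : ∀ k u, ‖emb (πs k (L (πs k u)))‖ ≤ M * ‖emb u‖

namespace DFLYGalerkin

variable {Bs Bw : Type*} [NormedAddCommGroup Bs] [NormedSpace ℂ Bs]
    [NormedAddCommGroup Bw] [NormedSpace ℂ Bw]

/-- The discretized operator `L_k = π_k L π_k` on the strong space. -/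
def Lk (S : DFLYGalerkin Bs Bw) (k : ℕ) : Bs →L[ℂ] Bs :=
  (S.πs k).comp (S.L.comp (S.πs k))

/-- The discretized operator `L_k = π_k L π_k` on the weak space. -/
def LkWeak (S : DFLYGalerkin Bs Bw) (k : ℕ) : Bw →L[ℂ] Bw :=
  (S.π k).comp (S.Lw.comp (S.π k))

/-- The operator norm `‖T‖_{s→w}` of an operator on the strong space. -/
def normSW (S : DFLYGalerkin Bs Bw) (T : Bs →L[ℂ] Bs) : ℝ := ‖S.emb.comp T‖

/-- The mixed discrepancy `δ_k = ‖L - L_k‖_{s→w}`. -/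
def δ (S : DFLYGalerkin Bs Bw) (k : ℕ) : ℝ := S.normSW (S.L - S.Lk k)

/-- The norm equivalence constant `E_{k,w→s} = sup ‖u‖_s / ‖u‖_w` over the nonzero elements `u` of
the range of `π_k` (a bounded set of ratios since the range is finite-dimensional; the constant
is `0` if the range is zero). -/
def normEquiv (S : DFLYGalerkin Bs Bw) (k : ℕ) : ℝ :=
  sSup {r : ℝ | ∃ u : Bs, S.emb u ∈ Set.range (S.π k) ∧ u ≠ 0 ∧ r = ‖u‖ / ‖S.emb u‖}

/-- The exponent `|log (μ / M)| / |log (a / M)|`. -/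
def exponent (S : DFLYGalerkin Bs Bw) (μ : ℝ) : ℝ :=
  |Real.log (μ / S.M)| / |Real.log (S.a / S.M)|

end DFLYGalerkin

end

/-! This is Keller–Liverani perturbation theory. A perturbation that is small only from the strong
to the weak norm is still harmless, because the Doeblin–Fortet–Lasota–Yorke (DFLY) inequality
recovers the strong norm from the weak one. Iterating it inside (z-A)⁻¹ = Σ_{j<n} z^{-j-1} A^j +
z^{-n} (z-A)⁻¹ A^n gives, for |z| ≥ μ > a, the mixed bound ‖(z-A)⁻¹g‖_w ≤ c((a/μ)^n ‖g‖_s + (M/μ)^n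
‖g‖_w). Here n is free, and c depends only on the constants, the embedding norm and a strong
resolvent bound (`IsDFLY.norm_emb_resolvent_le`). Since δ_k → 0, it follows that the strong
resolvents of L_k are uniformly bounded on Γ (`exists_norm_le_of_mixed_close`) and that resolvents
and Riesz projectors converge in the s→w norm.

On Ran π_k the strong norm is at most E_k times the weak one. Balancing the two terms in n bounds
the weak resolvent by O(1 + E_k^q), and the rate hypothesis then gives the spectral window.

For equal ranks it suffices that Pu = u, Qu = 0 forces u = 0, and the same with P and Q exchanged,
where P, Q are the projectors of L, L_k. On such u the strong norm is dominated by the weak norm: if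
the boundary does not wind around 0 this is read off from the projector that fixes u, otherwise from
the one that kills u (`exists_norm_le_of_winding`). Then ‖u‖_s ≤ D‖(Q-P)u‖_w < ‖u‖_s unless u = 0.
Ranks may be infinite when 0 ∈ U. Idempotence of Q holds because generalized eigenspaces of L_k span
the space and Q acts on each by a winding number; idempotence of P follows in the limit.

For the eigenvalue statements, an analytic determinant shows that spectrum of modulus above μ is
isolated, so λ sits alone in a small circle. The projector of L_k applied to an eigenvector u of L
tends weakly to u, which produces generalized eigenvectors. Genuine eigenvectors come from
compactness: normalized eigenvectors of L_k approach the finite-dimensional range of P. -/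

noncomputable section

/-! ### Contour integrals over piecewise C¹ cycles. -/

section ContourIntegral

open MeasureTheory

variable {E F : Type*} [NormedAddCommGroup E] [NormedSpace ℂ E]
  [NormedAddCommGroup F] [NormedSpace ℂ F]

namespace PiecewiseC1Loop

lemma exists_countable_hasDerivAt (γ : PiecewiseC1Loop) :
    ∃ s : Set ℝ, s.Countable ∧
      ∀ t ∈ Set.Ioo (0 : ℝ) 1 \ s, HasDerivAt γ.toFun (deriv γ.toFun t) t := by
  obtain ⟨n, t, h0, h1, hlt, hC⟩ := γ.piecewise
  refine ⟨t '' Set.Iic n, (Set.finite_Iic n).countable.image t, fun x hx ↦ ?_⟩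
  have key : ∀ m ≤ n, x < t m → ∃ j < m, t j < x ∧ x < t (j + 1) := by
    intro m
    induction m with
    | zero => intro _ hxm; rw [h0] at hxm; exact absurd hx.1.1 (not_lt.2 hxm.le)
    | succ m ih =>
      intro hm hxm
      rcases lt_trichotomy x (t m) with h | h | h
      · obtain ⟨j, hj, h'⟩ := ih (by omega) h
        exact ⟨j, by omega, h'⟩
      · exact absurd ⟨m, by simp only [Set.mem_Iic]; omega, h.symm⟩ hx.2
      · exact ⟨m, by omega, h, hxm⟩
  obtain ⟨j, hj, hj1, hj2⟩ := key n le_rfl (h1 ▸ hx.1.2)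
  have hnhds : Set.Icc (t j) (t (j + 1)) ∈ 𝓝 x := Icc_mem_nhds hj1 hj2
  exact (((hC j hj).differentiableOn one_ne_zero).differentiableAt hnhds).hasDerivAt

lemma intervalIntegrable_deriv (γ : PiecewiseC1Loop) :
    IntervalIntegrable (deriv γ.toFun) volume 0 1 := by
  obtain ⟨n, t, h0, h1, hlt, hC⟩ := γ.piecewise
  rw [← h0, ← h1]
  refine IntervalIntegrable.trans_iterate fun j hj ↦ ?_
  have hle := (hlt j hj).le
  have hcont : ContinuousOn (derivWithin γ.toFun (Set.Icc (t j) (t (j + 1))))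
      (Set.uIcc (t j) (t (j + 1))) := by
    rw [Set.uIcc_of_le hle]
    exact (hC j hj).continuousOn_derivWithin (uniqueDiffOn_Icc (hlt j hj)) le_rfl
  refine hcont.intervalIntegrable.congr_uIoo fun x hx ↦ ?_
  rw [Set.uIoo_of_le hle] at hx
  exact derivWithin_of_mem_nhds (Icc_mem_nhds hx.1 hx.2)

lemma isCompact_trace (γ : PiecewiseC1Loop) : IsCompact γ.trace :=
  isCompact_Icc.image_of_continuousOn γ.continuousOn

lemma mem_trace (γ : PiecewiseC1Loop) {t : ℝ} (ht : t ∈ Set.Icc (0 : ℝ) 1) :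
    γ.toFun t ∈ γ.trace := ⟨t, ht, rfl⟩

lemma intervalIntegrable (γ : PiecewiseC1Loop) {f : ℂ → E} (hf : ContinuousOn f γ.trace) :
    IntervalIntegrable (fun t ↦ deriv γ.toFun t • f (γ.toFun t)) volume 0 1 := by
  refine γ.intervalIntegrable_deriv.smul_continuousOn ?_
  rw [Set.uIcc_of_le zero_le_one]
  exact hf.comp γ.continuousOn fun t ht ↦ γ.mem_trace ht

lemma integral_sub (γ : PiecewiseC1Loop) {f g : ℂ → E} (hf : ContinuousOn f γ.trace)
    (hg : ContinuousOn g γ.trace) :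
    γ.integral (fun z ↦ f z - g z) = γ.integral f - γ.integral g := by
  simp only [integral, smul_sub]
  exact intervalIntegral.integral_sub (γ.intervalIntegrable hf) (γ.intervalIntegrable hg)

lemma integral_add (γ : PiecewiseC1Loop) {f g : ℂ → E} (hf : ContinuousOn f γ.trace)
    (hg : ContinuousOn g γ.trace) :
    γ.integral (fun z ↦ f z + g z) = γ.integral f + γ.integral g := by
  simp only [integral, smul_add]
  exact intervalIntegral.integral_add (γ.intervalIntegrable hf) (γ.intervalIntegrable hg)

lemma integral_clm [CompleteSpace E] [CompleteSpace F] (γ : PiecewiseC1Loop) {f : ℂ → E}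
    (hf : ContinuousOn f γ.trace) (T : E →L[ℂ] F) :
    γ.integral (fun z ↦ T (f z)) = T (γ.integral f) := by
  simp only [integral]
  rw [← T.intervalIntegral_comp_comm (γ.intervalIntegrable hf)]
  simp only [map_smul]

lemma integral_smul_const [CompleteSpace E] (γ : PiecewiseC1Loop) (f : ℂ → ℂ) (v : E) :
    γ.integral (fun z ↦ f z • v) = γ.integral f • v := by
  simp only [integral, ← smul_assoc]
  exact intervalIntegral.integral_smul_const _ _

lemma integral_congr (γ : PiecewiseC1Loop) {f g : ℂ → E} (h : Set.EqOn f g γ.trace) :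
    γ.integral f = γ.integral g := by
  refine intervalIntegral.integral_congr fun t ht ↦ ?_
  rw [Set.uIcc_of_le zero_le_one] at ht
  simp only [h (γ.mem_trace ht)]

lemma norm_integral_le (γ : PiecewiseC1Loop) {f : ℂ → E} {K : ℝ}
    (hf : ∀ z ∈ γ.trace, ‖f z‖ ≤ K) :
    ‖γ.integral f‖ ≤ (∫ t in (0 : ℝ)..1, ‖deriv γ.toFun t‖) * K := by
  rw [← intervalIntegral.integral_mul_const]
  refine intervalIntegral.norm_integral_le_of_norm_le zero_le_one ?_
    (γ.intervalIntegrable_deriv.norm.mul_const K)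
  refine Eventually.of_forall fun t ht ↦ ?_
  rw [norm_smul]
  exact mul_le_mul_of_nonneg_left (hf _ (γ.mem_trace ⟨ht.1.le, ht.2⟩)) (norm_nonneg _)

/-- The fundamental theorem of calculus tolerates a countable exceptional set, here the breakpoints
of the curve; the endpoint values cancel since the curve is closed. -/
lemma integral_eq_zero_of_hasDerivAt [CompleteSpace E] (γ : PiecewiseC1Loop) {f f' : ℂ → E}
    (hf : ∀ z ∈ γ.trace, HasDerivAt f (f' z) z) (hf' : ContinuousOn f' γ.trace) :
    γ.integral f' = 0 := by
  obtain ⟨s, hs, hd⟩ := γ.exists_countable_hasDerivAt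
  have := integral_eq_of_hasDerivAt_off_countable_of_le (fun t ↦ f (γ.toFun t))
    (fun t ↦ deriv γ.toFun t • f' (γ.toFun t)) zero_le_one hs
    (ContinuousOn.comp (t := γ.trace) (fun z hz ↦ (hf z hz).continuousAt.continuousWithinAt)
      γ.continuousOn fun t ht ↦ γ.mem_trace ht)
    (fun t ht ↦ (hf _ (γ.mem_trace ⟨ht.1.1.le, ht.1.2.le⟩)).scomp t (hd t ht))
    (γ.intervalIntegrable hf')
  rw [integral, this, γ.closed, sub_self]

end PiecewiseC1Loop

variable {n : ℕ} (C : Fin n → PiecewiseC1Loop)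

/-- The set of points on a cycle. -/
def cycleTrace : Set ℂ := ⋃ j, (C j).trace

/-- The total length of a cycle. -/
def cycleLength : ℝ := ∑ j, ∫ t in (0 : ℝ)..1, ‖deriv (C j).toFun t‖

lemma trace_subset_cycleTrace (j : Fin n) : (C j).trace ⊆ cycleTrace C :=
  Set.subset_iUnion (fun j ↦ (C j).trace) j

lemma isCompact_cycleTrace : IsCompact (cycleTrace C) :=
  isCompact_iUnion fun j ↦ (C j).isCompact_trace

lemma cycleLength_nonneg : 0 ≤ cycleLength C :=
  Finset.sum_nonneg fun _ _ ↦
    intervalIntegral.integral_nonneg zero_le_one fun _ _ ↦ norm_nonneg _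

variable {C}

lemma cycleIntegral_sub {f g : ℂ → E} (hf : ContinuousOn f (cycleTrace C))
    (hg : ContinuousOn g (cycleTrace C)) :
    cycleIntegral C (fun z ↦ f z - g z) = cycleIntegral C f - cycleIntegral C g := by
  simp only [cycleIntegral, ← Finset.sum_sub_distrib]
  exact Finset.sum_congr rfl fun j _ ↦ (C j).integral_sub
    (hf.mono (trace_subset_cycleTrace C j)) (hg.mono (trace_subset_cycleTrace C j))

lemma cycleIntegral_add {f g : ℂ → E} (hf : ContinuousOn f (cycleTrace C))
    (hg : ContinuousOn g (cycleTrace C)) :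
    cycleIntegral C (fun z ↦ f z + g z) = cycleIntegral C f + cycleIntegral C g := by
  simp only [cycleIntegral, ← Finset.sum_add_distrib]
  exact Finset.sum_congr rfl fun j _ ↦ (C j).integral_add
    (hf.mono (trace_subset_cycleTrace C j)) (hg.mono (trace_subset_cycleTrace C j))

lemma cycleIntegral_clm [CompleteSpace E] [CompleteSpace F] {f : ℂ → E}
    (hf : ContinuousOn f (cycleTrace C)) (T : E →L[ℂ] F) :
    cycleIntegral C (fun z ↦ T (f z)) = T (cycleIntegral C f) := by
  simp only [cycleIntegral, map_sum]
  exact Finset.sum_congr rfl fun j _ ↦ (C j).integral_clm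
    (hf.mono (trace_subset_cycleTrace C j)) T

lemma cycleIntegral_smul_const [CompleteSpace E] (f : ℂ → ℂ) (v : E) :
    cycleIntegral C (fun z ↦ f z • v) = cycleIntegral C f • v := by
  simp only [cycleIntegral, Finset.sum_smul, PiecewiseC1Loop.integral_smul_const]

lemma cycleIntegral_congr {f g : ℂ → E} (h : Set.EqOn f g (cycleTrace C)) :
    cycleIntegral C f = cycleIntegral C g :=
  Finset.sum_congr rfl fun j _ ↦ (C j).integral_congr (h.mono (trace_subset_cycleTrace C j))

lemma norm_cycleIntegral_le {f : ℂ → E} {K : ℝ} (hf : ∀ z ∈ cycleTrace C, ‖f z‖ ≤ K) :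
    ‖cycleIntegral C f‖ ≤ cycleLength C * K := by
  rw [cycleLength, Finset.sum_mul]
  exact norm_sum_le_of_le _ fun j _ ↦
    (C j).norm_integral_le fun z hz ↦ hf z (trace_subset_cycleTrace C j hz)

lemma cycleIntegral_eq_zero_of_hasDerivAt [CompleteSpace E] {f f' : ℂ → E}
    (hf : ∀ z ∈ cycleTrace C, HasDerivAt f (f' z) z) (hf' : ContinuousOn f' (cycleTrace C)) :
    cycleIntegral C f' = 0 :=
  Finset.sum_eq_zero fun j _ ↦ (C j).integral_eq_zero_of_hasDerivAt
    (fun z hz ↦ hf z (trace_subset_cycleTrace C j hz))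
    (hf'.mono (trace_subset_cycleTrace C j))

/-- Every power of z - c below -1 has a single-valued primitive. Together with the winding numbers
this replaces Cauchy's theorem throughout. -/
lemma cycleIntegral_sub_inv_pow {c : ℂ} (hc : c ∉ cycleTrace C) (m : ℕ) :
    cycleIntegral C (fun z ↦ ((z - c) ^ (m + 2))⁻¹) = 0 := by
  have hne : ∀ z ∈ cycleTrace C, z - c ≠ 0 := fun z hz h ↦
    hc (by rwa [← sub_eq_zero.1 h])
  refine cycleIntegral_eq_zero_of_hasDerivAt (f := fun z ↦ -(m + 1 : ℂ)⁻¹ * ((z - c) ^ (m + 1))⁻¹)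
    (fun z hz ↦ ?_) ?_
  · have h1 : HasDerivAt (fun z : ℂ ↦ (z - c) ^ (m + 1)) ((m + 1 : ℕ) * (z - c) ^ m * 1) z := by
      simpa using ((hasDerivAt_id z).sub_const c).fun_pow (m + 1)
    have h2 := (h1.inv (pow_ne_zero _ (hne z hz))).const_mul (-(m + 1 : ℂ)⁻¹)
    refine h2.congr_deriv ?_
    have := hne z hz
    have hm : (m + 1 : ℂ) ≠ 0 := by exact_mod_cast Nat.succ_ne_zero m
    push_cast
    field_simp
    ring
  · exact ContinuousOn.inv₀ (by fun_prop) fun z hz ↦ pow_ne_zero _ (hne z hz)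

lemma cycleIntegral_const (v : E) [CompleteSpace E] : cycleIntegral C (fun _ ↦ v) = 0 :=
  cycleIntegral_eq_zero_of_hasDerivAt (f := fun z : ℂ ↦ z • v)
    (fun z _ ↦ by simpa using (hasDerivAt_id z).smul_const v) continuousOn_const

lemma cycleIntegral_sum [CompleteSpace E] {ι : Type*} (s : Finset ι) {f : ι → ℂ → E}
    (hf : ∀ i ∈ s, ContinuousOn (f i) (cycleTrace C)) :
    cycleIntegral C (fun z ↦ ∑ i ∈ s, f i z) = ∑ i ∈ s, cycleIntegral C (f i) := by
  classical
  induction s using Finset.induction_on with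
  | empty => simpa using cycleIntegral_const (C := C) (0 : E)
  | insert i s hi ih =>
    have h2 : ∀ j ∈ s, ContinuousOn (f j) (cycleTrace C) := fun j hj ↦
      hf j (Finset.mem_insert_of_mem hj)
    simp only [Finset.sum_insert hi]
    rw [cycleIntegral_add (hf i (Finset.mem_insert_self i s)) (continuousOn_finsetSum s h2), ih h2]

lemma norm_two_pi_I_inv_le : ‖(2 * (Real.pi : ℂ) * Complex.I)⁻¹‖ ≤ 1 := by
  rw [norm_inv]
  refine inv_le_one_of_one_le₀ ?_
  have : (1 : ℝ) ≤ 2 * Real.pi := by linarith [Real.pi_gt_three]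
  simpa [abs_of_pos Real.pi_pos] using this

lemma norm_two_pi_I_inv_smul_cycleIntegral_le {f : ℂ → E} {K : ℝ}
    (hf : ∀ z ∈ cycleTrace C, ‖f z‖ ≤ K) :
    ‖(2 * (Real.pi : ℂ) * Complex.I)⁻¹ • cycleIntegral C f‖ ≤ cycleLength C * K := by
  rw [norm_smul]
  exact (mul_le_of_le_one_left (norm_nonneg _) norm_two_pi_I_inv_le).trans
    (norm_cycleIntegral_le hf)

end ContourIntegral

/-! ### Resolvent identities. -/

section Resolvent

variable {E : Type*} [NormedAddCommGroup E] [NormedSpace ℂ E]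

lemma smul_resolvent_apply_sub {A : E →L[ℂ] E} {z : ℂ} (hz : z ∈ resolventSet ℂ A) (u : E) :
    z • resolvent A z u - A (resolvent A z u) = u := by
  have h := Ring.mul_inverse_cancel _ (spectrum.mem_resolventSet_iff.1 hz)
  have := DFunLike.congr_fun h u
  simpa [resolvent, Algebra.algebraMap_eq_smul_one] using this

lemma resolvent_apply_smul_sub {A : E →L[ℂ] E} {z : ℂ} (hz : z ∈ resolventSet ℂ A) (u : E) :
    resolvent A z (z • u - A u) = u := by
  have h := Ring.inverse_mul_cancel _ (spectrum.mem_resolventSet_iff.1 hz)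
  have := DFunLike.congr_fun h u
  simpa [resolvent, Algebra.algebraMap_eq_smul_one] using this

lemma resolvent_apply_eq_of {A : E →L[ℂ] E} {z : ℂ} (hz : z ∈ resolventSet ℂ A) {u f : E}
    (h : z • u - A u = f) : resolvent A z f = u := by
  rw [← h, resolvent_apply_smul_sub hz]

lemma norm_resolvent_le_of_lower_bound {A : E →L[ℂ] E} {z : ℂ} (hz : z ∈ resolventSet ℂ A) {K : ℝ}
    (hK0 : 0 ≤ K) (hK : ∀ u, ‖u‖ ≤ K * ‖z • u - A u‖) : ‖resolvent A z‖ ≤ K :=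
  ContinuousLinearMap.opNorm_le_bound _ hK0 fun f ↦ by
    simpa only [smul_resolvent_apply_sub hz] using hK (resolvent A z f)

lemma resolvent_sub_resolvent_apply {A B : E →L[ℂ] E} {z : ℂ} (hA : z ∈ resolventSet ℂ A)
    (hB : z ∈ resolventSet ℂ B) (u : E) :
    resolvent B z u - resolvent A z u = resolvent A z ((B - A) (resolvent B z u)) := by
  symm
  refine resolvent_apply_eq_of hA ?_
  have h1 := smul_resolvent_apply_sub hA u
  have h2 := smul_resolvent_apply_sub hB u
  rw [smul_sub, map_sub, sub_apply]
  rw [sub_eq_iff_eq_add] at h1 h2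
  rw [h1, h2]
  abel

/-- A finite Neumann expansion with exact remainder: no smallness of A/z is required, only that z
lies in the resolvent set. -/
lemma resolvent_apply_eq_sum_add {A : E →L[ℂ] E} {z : ℂ} (hz : z ∈ resolventSet ℂ A)
    (hz0 : z ≠ 0) (n : ℕ) (u : E) :
    resolvent A z u = (∑ j ∈ Finset.range n, (z ^ (j + 1))⁻¹ • (A ^ j) u) +
      (z ^ n)⁻¹ • resolvent A z ((A ^ n) u) := by
  induction n with
  | zero => simp
  | succ n ih =>
    rw [ih, Finset.sum_range_succ, add_assoc]
    congr 1
    have h : resolvent A z ((A ^ n) u) =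
        z⁻¹ • (A ^ n) u + z⁻¹ • resolvent A z ((A ^ (n + 1)) u) := by
      refine resolvent_apply_eq_of hz ?_
      have h1 := smul_resolvent_apply_sub hz ((A ^ (n + 1)) u)
      have h2 : (A ^ (n + 1)) u = A ((A ^ n) u) := by rw [pow_succ']; rfl
      simp only [smul_add, map_add, map_smul, smul_inv_smul₀ hz0]
      rw [sub_eq_iff_eq_add] at h1
      rw [← h2]
      have h3 : A (resolvent A z ((A ^ (n + 1)) u)) =
          z • resolvent A z ((A ^ (n + 1)) u) - (A ^ (n + 1)) u := by rw [h1]; abel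
      rw [h3, smul_sub, inv_smul_smul₀ hz0]
      abel
    rw [h, smul_add, smul_smul, smul_smul, ← mul_inv, ← pow_succ]

lemma continuousOn_resolvent [CompleteSpace E] (A : E →L[ℂ] E) :
    ContinuousOn (resolvent A) (resolventSet ℂ A) := fun _ hz ↦
  (spectrum.hasDerivAt_resolvent_const_left hz).continuousAt.continuousWithinAt

lemma exists_norm_resolvent_le [CompleteSpace E] (A : E →L[ℂ] E) {Γ : Set ℂ} (hΓ : IsCompact Γ)
    (h : Γ ⊆ resolventSet ℂ A) : ∃ K, 0 < K ∧ ∀ z ∈ Γ, ‖resolvent A z‖ ≤ K := by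
  obtain ⟨K, hK⟩ := hΓ.exists_bound_of_continuousOn ((continuousOn_resolvent A).mono h)
  exact ⟨max K 1, by positivity, fun z hz ↦ (hK z hz).trans (le_max_left _ _)⟩

lemma mem_resolventSet_of_bijective [CompleteSpace E] {A : E →L[ℂ] E} {z : ℂ}
    (h : Function.Bijective fun u ↦ z • u - A u) : z ∈ resolventSet ℂ A := by
  rw [spectrum.mem_resolventSet_iff, ContinuousLinearMap.isUnit_iff_bijective]
  convert h using 2
  simp [Algebra.algebraMap_eq_smul_one]

end Resolvent

/-! ### Riesz projectors expressed through winding numbers. -/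

section RieszProjector

variable {E F : Type*} [NormedAddCommGroup E] [NormedSpace ℂ E] [CompleteSpace E]
  [NormedAddCommGroup F] [NormedSpace ℂ F] [CompleteSpace F]
  {n : ℕ} {C : Fin n → PiecewiseC1Loop} {A : E →L[ℂ] E}

lemma continuousOn_resolvent_apply (h : cycleTrace C ⊆ resolventSet ℂ A) (u : E) :
    ContinuousOn (fun z ↦ resolvent A z u) (cycleTrace C) :=
  ((continuousOn_resolvent A).mono h).clm_apply continuousOn_const

lemma clm_rieszProjector_apply (h : cycleTrace C ⊆ resolventSet ℂ A) (T : E →L[ℂ] F) (u : E) :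
    T (rieszProjector C A u) =
      (2 * (Real.pi : ℂ) * Complex.I)⁻¹ • cycleIntegral C (fun z ↦ T (resolvent A z u)) := by
  have := cycleIntegral_clm ((continuousOn_resolvent A).mono h)
    (T.comp (ContinuousLinearMap.apply ℂ E u))
  simp only [ContinuousLinearMap.comp_apply, ContinuousLinearMap.apply_apply] at this
  rw [this, rieszProjector, smul_apply, map_smul]

lemma rieszProjector_apply (h : cycleTrace C ⊆ resolventSet ℂ A) (u : E) :
    rieszProjector C A u =
      (2 * (Real.pi : ℂ) * Complex.I)⁻¹ • cycleIntegral C (fun z ↦ resolvent A z u) :=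
  clm_rieszProjector_apply h (ContinuousLinearMap.id ℂ E) u

lemma norm_clm_rieszProjector_apply_le (h : cycleTrace C ⊆ resolventSet ℂ A) (T : E →L[ℂ] F)
    (u : E) {K : ℝ} (hK : ∀ z ∈ cycleTrace C, ‖T (resolvent A z u)‖ ≤ K) :
    ‖T (rieszProjector C A u)‖ ≤ cycleLength C * K := by
  rw [clm_rieszProjector_apply h]
  exact norm_two_pi_I_inv_smul_cycleIntegral_le hK

/-- In the finite expansion of the resolvent only the 1/z term has a nonzero integral. The remainder
contains a high power of A, to which the iterated DFLY bound applies. -/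
lemma rieszProjector_apply_eq_winding_smul_add (h : cycleTrace C ⊆ resolventSet ℂ A)
    (h0 : 0 ∉ cycleTrace C) (m : ℕ) (u : E) :
    rieszProjector C A u = cycleWinding C 0 • u +
      (2 * (Real.pi : ℂ) * Complex.I)⁻¹ •
        cycleIntegral C (fun z ↦ (z ^ (m + 1))⁻¹ • resolvent A z ((A ^ (m + 1)) u)) := by
  have hne : ∀ z ∈ cycleTrace C, z ≠ 0 := fun z hz h ↦ h0 (h ▸ hz)
  have hc : ∀ j : ℕ, ContinuousOn (fun z : ℂ ↦ (z ^ j)⁻¹) (cycleTrace C) := fun j ↦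
    ContinuousOn.inv₀ (by fun_prop) fun z hz ↦ pow_ne_zero _ (hne z hz)
  have hcs : ∀ (j : ℕ) (v : E), ContinuousOn (fun z : ℂ ↦ (z ^ j)⁻¹ • v) (cycleTrace C) :=
    fun j v ↦ (hc j).smul continuousOn_const
  have hadd := cycleIntegral_add
    (continuousOn_finsetSum (Finset.range (m + 1)) fun j _ ↦ hcs (j + 1) ((A ^ j) u))
    ((hc (m + 1)).fun_smul (continuousOn_resolvent_apply h ((A ^ (m + 1)) u)))
  rw [rieszProjector_apply h, cycleIntegral_congr fun z hz ↦
    resolvent_apply_eq_sum_add (h hz) (hne z hz) (m + 1) u, hadd,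
    cycleIntegral_sum _ fun j _ ↦ hcs _ _, Finset.sum_range_succ', smul_add]
  congr 1
  have hz : ∀ j : ℕ, cycleIntegral C (fun z ↦ (z ^ (j + 1 + 1))⁻¹ • (A ^ (j + 1)) u) = 0 := by
    intro j
    have := cycleIntegral_sub_inv_pow h0 j
    simp only [sub_zero] at this
    rw [cycleIntegral_smul_const, this, zero_smul]
  rw [Finset.sum_eq_zero fun j _ ↦ hz j, zero_add, cycleIntegral_smul_const, smul_smul,
    cycleWinding]
  simp

/-- Expanded in powers of z - c, the resolvent terminates on u because A - c is nilpotent there;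
only the simple pole contributes. -/
lemma rieszProjector_apply_of_genEigen (h : cycleTrace C ⊆ resolventSet ℂ A) {c : ℂ}
    (hc : c ∉ cycleTrace C) (m : ℕ) (u : E) (hu : ((A - c • 1) ^ m) u = 0) :
    rieszProjector C A u = cycleWinding C c • u := by
  set N := A - c • 1 with hN
  have hne : ∀ z ∈ cycleTrace C, z - c ≠ 0 := fun z hz h ↦
    hc (by rwa [← sub_eq_zero.1 h])
  have hcs : ∀ (j : ℕ) (v : E), ContinuousOn (fun z : ℂ ↦ ((z - c) ^ j)⁻¹ • v) (cycleTrace C) :=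
    fun j v ↦ (ContinuousOn.inv₀ (by fun_prop) fun z hz ↦ pow_ne_zero _ (hne z hz)).smul
      continuousOn_const
  have hres : ∀ z ∈ cycleTrace C, resolvent A z u =
      ∑ j ∈ Finset.range (m + 1), ((z - c) ^ (j + 1))⁻¹ • (N ^ j) u := by
    intro z hz
    have hzN : z - c ∈ resolventSet ℂ N := by
      have := h hz
      rw [spectrum.mem_resolventSet_iff] at this ⊢
      convert this using 1
      rw [hN, map_sub, Algebra.algebraMap_eq_smul_one, Algebra.algebraMap_eq_smul_one]
      abel
    have hR : resolvent A z u = resolvent N (z - c) u := by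
      refine resolvent_apply_eq_of (h hz) ?_
      have := smul_resolvent_apply_sub hzN u
      simp only [hN, sub_apply, smul_apply,
        one_apply_eq_self, sub_smul] at this ⊢
      refine Eq.trans ?_ this
      abel
    have hu' : (N ^ (m + 1)) u = 0 := by
      rw [pow_succ']
      exact (congrArg N hu).trans (map_zero N)
    rw [hR, resolvent_apply_eq_sum_add hzN (hne z hz) (m + 1) u, hu']
    simp
  rw [rieszProjector_apply h, cycleIntegral_congr hres, cycleIntegral_sum _ fun j _ ↦ hcs _ _,
    Finset.sum_range_succ']
  have hz : ∀ j : ℕ, cycleIntegral C (fun z ↦ ((z - c) ^ (j + 1 + 1))⁻¹ • (N ^ (j + 1)) u) = 0 := by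
    intro j
    rw [cycleIntegral_smul_const, cycleIntegral_sub_inv_pow hc j, zero_smul]
  rw [Finset.sum_eq_zero fun j _ ↦ hz j, zero_add, cycleIntegral_smul_const, smul_smul,
    cycleWinding]
  simp

end RieszProjector

/-- The one-step Doeblin–Fortet–Lasota–Yorke bounds for an operator `A` on the strong space. -/
structure IsDFLY {X Y : Type*} [NormedAddCommGroup X] [NormedSpace ℂ X]
    [NormedAddCommGroup Y] [NormedSpace ℂ Y] (emb : X →L[ℂ] Y) (a b M : ℝ) (A : X →L[ℂ] X) :
    Prop where
  strong : ∀ u, ‖A u‖ ≤ a * ‖u‖ + b * ‖emb u‖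
  weak : ∀ u, ‖emb (A u)‖ ≤ M * ‖emb u‖

/-! ### Iterated DFLY bounds and their consequences for resolvents. -/

namespace IsDFLY

variable {X Y : Type*} [NormedAddCommGroup X] [NormedSpace ℂ X]
  [NormedAddCommGroup Y] [NormedSpace ℂ Y]
  {emb : X →L[ℂ] Y} {a b M μ : ℝ} {A L : X →L[ℂ] X}

lemma weak_pow (h : IsDFLY emb a b M A) (hM : 0 < M) (n : ℕ) (u : X) :
    ‖emb ((A ^ n) u)‖ ≤ M ^ n * ‖emb u‖ := by
  induction n with
  | zero => simp
  | succ n ih =>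
    rw [pow_succ', pow_succ', mul_assoc]
    exact (h.weak _).trans (mul_le_mul_of_nonneg_left ih hM.le)

/-- The weak terms accumulate to b Σ a^{n-1-j} M^j = b (M^n - a^n)/(M - a). -/
lemma strong_pow (h : IsDFLY emb a b M A) (ha : 0 < a) (hb : 0 < b) (haM : a < M) (n : ℕ)
    (u : X) : ‖(A ^ n) u‖ ≤ a ^ n * ‖u‖ + b / (M - a) * (M ^ n * ‖emb u‖) := by
  have hd : 0 < M - a := sub_pos.2 haM
  have hM : 0 < M := ha.trans haM
  induction n with
  | zero => simp only [pow_zero, one_mul]; exact le_add_of_nonneg_right (by positivity)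
  | succ n ih =>
    have h1 : ‖(A ^ (n + 1)) u‖ ≤ a * ‖(A ^ n) u‖ + b * ‖emb ((A ^ n) u)‖ := by
      rw [pow_succ']; exact h.strong _
    have h2 := mul_le_mul_of_nonneg_left ih ha.le
    have h3 := mul_le_mul_of_nonneg_left (h.weak_pow hM n u) hb.le
    calc ‖(A ^ (n + 1)) u‖ ≤ a * (a ^ n * ‖u‖ + b / (M - a) * (M ^ n * ‖emb u‖)) +
          b * (M ^ n * ‖emb u‖) := by linarith
      _ = _ := by field_simp; ring

lemma norm_apply_le (h : IsDFLY emb a b M A) (hb : 0 < b) (u : X) :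
    ‖A u‖ ≤ (a + b * ‖emb‖) * ‖u‖ := by
  have := mul_le_mul_of_nonneg_left (emb.le_opNorm u) hb.le
  linarith [h.strong u]

lemma sub_mul_norm_le (h : IsDFLY emb a b M A) (z : ℂ) (u : X) :
    (‖z‖ - a) * ‖u‖ ≤ ‖z • u - A u‖ + b * ‖emb u‖ := by
  have h1 : ‖z • u‖ ≤ ‖z • u - A u‖ + ‖A u‖ := norm_le_norm_sub_add _ _
  rw [norm_smul] at h1
  linarith [h.strong u]

/-- The constant in the weak bound on the resolvent. -/
def resolventConst (emb : X →L[ℂ] Y) (a b M μ K : ℝ) : ℝ :=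
  ‖emb‖ * K * (1 + b / (M - a)) + (M - μ)⁻¹

lemma resolventConst_nonneg {K : ℝ} (hb : 0 < b) (haμ : a < μ) (hμM : μ < M) (hK : 0 ≤ K) :
    0 ≤ resolventConst emb a b M μ K := by
  have h1 : 0 < M - a := by linarith
  have h2 : 0 < M - μ := by linarith
  unfold resolventConst
  positivity

lemma norm_inv_pow_smul_resolvent_pow_le (h : IsDFLY emb a b M A) (ha : 0 < a) (hb : 0 < b)
    (haμ : a < μ) (hμM : μ < M) {z : ℂ} (hμz : μ ≤ ‖z‖) {K : ℝ}
    (hK : ‖resolvent A z‖ ≤ K) (n : ℕ) (g : X) :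
    ‖(z ^ n)⁻¹ • resolvent A z ((A ^ n) g)‖ ≤
      K * ((a / μ) ^ n * ‖g‖ + b / (M - a) * ((M / μ) ^ n * ‖emb g‖)) := by
  have hμ : 0 < μ := ha.trans haμ
  have hK0 : 0 ≤ K := (norm_nonneg _).trans hK
  have hM : 0 < M := hμ.trans hμM
  have hd : 0 < M - a := by linarith
  rw [norm_smul, norm_inv, norm_pow]
  calc (‖z‖ ^ n)⁻¹ * ‖resolvent A z ((A ^ n) g)‖
      ≤ (μ ^ n)⁻¹ * (K * (a ^ n * ‖g‖ + b / (M - a) * (M ^ n * ‖emb g‖))) := by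
        gcongr
        exact ((resolvent A z).le_opNorm _).trans
          (mul_le_mul hK (h.strong_pow ha hb (haμ.trans hμM) n g) (norm_nonneg _) hK0)
    _ = _ := by rw [div_pow, div_pow]; field_simp

/-- The finite Neumann sum is estimated in the weak norm alone, as a geometric series of ratio M/μ.
Only the remainder uses the strong norm, where it carries the contracting factor (a/μ)^n. -/
lemma norm_emb_resolvent_le (h : IsDFLY emb a b M A) (ha : 0 < a) (hb : 0 < b)
    (haμ : a < μ) (hμM : μ < M) {z : ℂ} (hz : z ∈ resolventSet ℂ A) (hμz : μ ≤ ‖z‖) {K : ℝ}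
    (hK : ‖resolvent A z‖ ≤ K) (n : ℕ) (g : X) :
    ‖emb (resolvent A z g)‖ ≤ resolventConst emb a b M μ K *
      ((a / μ) ^ n * ‖g‖ + (M / μ) ^ n * ‖emb g‖) := by
  have hμ : 0 < μ := ha.trans haμ
  have hM : 0 < M := hμ.trans hμM
  have hd : 0 < M - a := by linarith
  have hd' : 0 < M - μ := by linarith
  have hK0 : 0 ≤ K := (norm_nonneg _).trans hK
  have hz0 : z ≠ 0 := fun h0 ↦ by simp [h0] at hμz; linarith
  have h1 : ‖∑ j ∈ Finset.range n, emb ((z ^ (j + 1))⁻¹ • (A ^ j) g)‖ ≤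
      (M - μ)⁻¹ * ((M / μ) ^ n * ‖emb g‖) := by
    calc ‖∑ j ∈ Finset.range n, emb ((z ^ (j + 1))⁻¹ • (A ^ j) g)‖
        ≤ ∑ j ∈ Finset.range n, (μ ^ (j + 1))⁻¹ * (M ^ j * ‖emb g‖) := by
          refine norm_sum_le_of_le _ fun j _ ↦ ?_
          rw [map_smul, norm_smul, norm_inv, norm_pow]
          gcongr
          exact h.weak_pow hM j g
      _ = (μ⁻¹ * ∑ j ∈ Finset.range n, (M / μ) ^ j) * ‖emb g‖ := by
          rw [Finset.mul_sum, Finset.sum_mul]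
          refine Finset.sum_congr rfl fun j _ ↦ ?_
          rw [div_pow, pow_succ]
          field_simp
      _ = (M - μ)⁻¹ * (((M / μ) ^ n - 1) * ‖emb g‖) := by
          have hne : M / μ ≠ 1 := by rw [Ne, div_eq_one_iff_eq hμ.ne']; exact hμM.ne'
          rw [geom_sum_eq hne]
          have : M / μ - 1 = (M - μ) / μ := by field_simp
          rw [this]
          field_simp
      _ ≤ _ := by gcongr; linarith
  have h2 := (emb.le_opNorm _).trans (mul_le_mul_of_nonneg_left
    (h.norm_inv_pow_smul_resolvent_pow_le ha hb haμ hμM hμz hK n g) (norm_nonneg emb))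
  rw [resolvent_apply_eq_sum_add hz hz0 n g, map_add, map_sum]
  refine (norm_add_le _ _).trans ((add_le_add h1 h2).trans ?_)
  have e1 : 0 ≤ (a / μ) ^ n * ‖g‖ := by positivity
  have e2 : 0 ≤ (M / μ) ^ n * ‖emb g‖ := by positivity
  have e3 : 0 ≤ ‖emb‖ * K := by positivity
  have e4 : 0 ≤ b / (M - a) := by positivity
  have e5 : 0 ≤ (M - μ)⁻¹ := by positivity
  unfold resolventConst
  nlinarith [mul_nonneg e3 e2, mul_nonneg (mul_nonneg e3 e4) e1, mul_nonneg e5 e1]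

/-- The mixed bound on resolvents, uniform over all operators with the same constants and a given
bound on the strong norm of the resolvent. -/
lemma exists_norm_emb_resolvent_le (emb : X →L[ℂ] Y) (ha : 0 < a) (hb : 0 < b)
    (haμ : a < μ) (hμM : μ < M) {K : ℝ} (hK0 : 0 ≤ K) {η : ℝ} (hη : 0 < η) :
    ∃ D, 0 < D ∧ ∀ A : X →L[ℂ] X, IsDFLY emb a b M A → ∀ z ∈ resolventSet ℂ A, μ ≤ ‖z‖ →
      ‖resolvent A z‖ ≤ K → ∀ g, ‖emb (resolvent A z g)‖ ≤ η * ‖g‖ + D * ‖emb g‖ := by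
  have hμ : 0 < μ := ha.trans haμ
  have hM : 0 < M := hμ.trans hμM
  have hc := resolventConst_nonneg (emb := emb) hb haμ hμM hK0
  set c := resolventConst emb a b M μ K
  -- Taking n large makes the strong coefficient at most η; the price is a large weak coefficient
  -- (M/μ)^n.
  obtain ⟨n, hn⟩ := exists_pow_lt_of_lt_one (show 0 < η / (c + 1) by positivity)
    ((div_lt_one hμ).2 haμ)
  refine ⟨c * (M / μ) ^ n + 1, by positivity, fun A hA z hz hμz hK g ↦ ?_⟩
  refine (hA.norm_emb_resolvent_le ha hb haμ hμM hz hμz hK n g).trans ?_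
  have h1 : c * (a / μ) ^ n ≤ η := by
    rw [lt_div_iff₀ (by positivity)] at hn
    have : 0 < (a / μ) ^ n := by positivity
    nlinarith
  nlinarith [mul_le_mul_of_nonneg_right h1 (norm_nonneg g), norm_nonneg (emb g)]

/-- The Keller–Liverani lower bound: it is stable under perturbations that are small in the mixed
norm. -/
lemma exists_norm_le_of_mixed_close (hL : IsDFLY emb a b M L) (ha : 0 < a) (hb : 0 < b)
    (haμ : a < μ) (hμM : μ < M) {Γ : Set ℂ} (hΓ : Γ ⊆ resolventSet ℂ L)
    (hμΓ : ∀ z ∈ Γ, μ ≤ ‖z‖) {K : ℝ} (hK0 : 0 ≤ K) (hK : ∀ z ∈ Γ, ‖resolvent L z‖ ≤ K) :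
    ∃ η > 0, ∃ K' > 0, ∀ A : X →L[ℂ] X, IsDFLY emb a b M A →
      (∀ u, ‖emb (A u - L u)‖ ≤ η * ‖u‖) → ∀ z ∈ Γ, ∀ u, ‖u‖ ≤ K' * ‖z • u - A u‖ := by
  have hd : 0 < μ - a := by linarith
  set N := 2 * (a + b * ‖emb‖) with hN
  have hN0 : 0 ≤ N := by positivity
  obtain ⟨D, hD0, hD⟩ := exists_norm_emb_resolvent_le emb ha hb haμ hμM hK0
    (show 0 < (μ - a) / (4 * b * (N + 1)) by positivity)
  refine ⟨(μ - a) / (4 * b * D), by positivity, 2 * (1 + b * (‖emb‖ * K)) / (μ - a), by positivity,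
    fun A hA hclose z hz u ↦ ?_⟩
  set f := z • u - A u with hf
  -- Only the resolvent of L is used; invertibility of z - A is not presupposed. The two
  -- contributions of A u - L u are each tuned to (μ-a)/(4b) times ‖u‖, so after multiplication by b
  -- half of (μ-a)‖u‖ can be absorbed.
  have hu : u = resolvent L z f + resolvent L z (A u - L u) := by
    rw [← map_add, show f + (A u - L u) = z • u - L u by rw [hf]; abel,
      resolvent_apply_smul_sub (hΓ hz)]
  have h1 : ‖emb (resolvent L z f)‖ ≤ ‖emb‖ * K * ‖f‖ := by
    rw [mul_assoc]
    exact (emb.le_opNorm _).trans (mul_le_mul_of_nonneg_left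
      (((resolvent L z).le_opNorm f).trans
        (mul_le_mul_of_nonneg_right (hK z hz) (norm_nonneg _))) (norm_nonneg _))
  have h2 := hD L hL z (hΓ hz) (hμΓ z hz) (hK z hz) (A u - L u)
  have h3 : ‖A u - L u‖ ≤ (N + 1) * ‖u‖ := by
    have := norm_sub_le (A u) (L u)
    have := hA.norm_apply_le hb u
    have := hL.norm_apply_le hb u
    nlinarith [norm_nonneg u]
  have h4 : ‖emb u‖ ≤ ‖emb‖ * K * ‖f‖ + ((μ - a) / (4 * b) + (μ - a) / (4 * b)) * ‖u‖ := by
    calc ‖emb u‖ ≤ ‖emb (resolvent L z f)‖ + ‖emb (resolvent L z (A u - L u))‖ := by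
          conv_lhs => rw [hu, map_add]
          exact norm_add_le _ _
      _ ≤ ‖emb‖ * K * ‖f‖ + ((μ - a) / (4 * b * (N + 1)) * ((N + 1) * ‖u‖) +
          D * ((μ - a) / (4 * b * D) * ‖u‖)) := by
          refine add_le_add h1 (h2.trans (add_le_add ?_ ?_))
          · exact mul_le_mul_of_nonneg_left h3 (by positivity)
          · exact mul_le_mul_of_nonneg_left (hclose u) hD0.le
      _ = _ := by field_simp
  have h5 := hA.sub_mul_norm_le z u
  have h6 : (μ - a) * ‖u‖ ≤ (‖z‖ - a) * ‖u‖ :=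
    mul_le_mul_of_nonneg_right (by linarith [hμΓ z hz]) (norm_nonneg _)
  have h7 : b * ‖emb u‖ ≤ b * (‖emb‖ * K) * ‖f‖ + (μ - a) / 2 * ‖u‖ := by
    refine (mul_le_mul_of_nonneg_left h4 hb.le).trans (le_of_eq ?_)
    field_simp
    ring
  rw [div_mul_eq_mul_div, le_div_iff₀ hd]
  linarith

variable [CompleteSpace X] {m : ℕ} {C : Fin m → PiecewiseC1Loop}

/-- P u minus the winding term is the remainder integral, whose strong part is at most ‖u‖/2 for
large n and is absorbed. The norm hypothesis covers two cases at once: P u = u with winding number 0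
about the origin, and P u = 0 with winding number 1. -/
lemma exists_norm_le_of_winding (emb : X →L[ℂ] Y) (ha : 0 < a) (hb : 0 < b)
    (haμ : a < μ) (hμM : μ < M) (C : Fin m → PiecewiseC1Loop)
    (hμC : ∀ z ∈ cycleTrace C, μ ≤ ‖z‖) {K : ℝ} (hK0 : 0 ≤ K) :
    ∃ D, 0 < D ∧ ∀ A : X →L[ℂ] X, IsDFLY emb a b M A → cycleTrace C ⊆ resolventSet ℂ A →
      (∀ z ∈ cycleTrace C, ‖resolvent A z‖ ≤ K) → ∀ u,
        ‖u‖ = ‖rieszProjector C A u - cycleWinding C 0 • u‖ → ‖u‖ ≤ D * ‖emb u‖ := by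
  have hμ : 0 < μ := ha.trans haμ
  have hM : 0 < M := hμ.trans hμM
  have hd : 0 < M - a := by linarith
  have hl := cycleLength_nonneg C
  set l := cycleLength C
  obtain ⟨n, hn⟩ := exists_pow_lt_of_lt_one (show 0 < 1 / (2 * (l * K + 1)) by positivity)
    ((div_lt_one hμ).2 haμ)
  refine ⟨2 * (l * K * (b / (M - a) * (M / μ) ^ (n + 1)) + 1), by positivity,
    fun A hA hC hK u hu ↦ ?_⟩
  have h0 : (0 : ℂ) ∉ cycleTrace C := fun h ↦ by
    have := hμC 0 h; simp at this; linarith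
  rw [rieszProjector_apply_eq_winding_smul_add hC h0 n u, add_sub_cancel_left] at hu
  have h1 := norm_two_pi_I_inv_smul_cycleIntegral_le fun z hz ↦
    hA.norm_inv_pow_smul_resolvent_pow_le ha hb haμ hμM (hμC z hz) (hK z hz) (n + 1) u
  rw [← hu] at h1
  have h2 : l * K * (a / μ) ^ (n + 1) ≤ 1 / 2 := by
    have h3 : (a / μ) ^ (n + 1) ≤ (a / μ) ^ n :=
      pow_le_pow_of_le_one (by positivity) ((div_lt_one hμ).2 haμ).le n.le_succ
    have hlK : 0 ≤ l * K := by positivity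
    rw [lt_div_iff₀ (by positivity)] at hn
    nlinarith [show 0 < (a / μ) ^ n by positivity]
  have h4 := mul_le_mul_of_nonneg_right h2 (norm_nonneg u)
  nlinarith [norm_nonneg (emb u)]

end IsDFLY

/-! ### Finite-dimensional linear algebra and ranges of projections. -/

section FiniteRank

open Module.End

/-- Split x as p x + (x - p x): the first part lies in a finite-dimensional invariant space, and f
kills the second, which is thus in the generalized eigenspace of 0. -/
lemma iSup_maxGenEigenspace_eq_top_of_isProj {K V : Type*} [Field K] [IsAlgClosed K]
    [AddCommGroup V] [Module K V] {f p : Module.End K V} (hfin : FiniteDimensional K (LinearMap.range p))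
    (hpf : ∀ x, p (f x) = f x) (hfp : ∀ x, f (p x) = f x) :
    ⨆ c : K, f.maxGenEigenspace c = ⊤ := by
  have hW : ∀ x ∈ LinearMap.range p, f x ∈ LinearMap.range p := fun x _ ↦ ⟨f x, hpf x⟩
  refine eq_top_iff.2 fun x _ ↦ ?_
  have h1 : ∀ w : LinearMap.range p, (w : V) ∈ ⨆ c : K, f.maxGenEigenspace c := by
    intro w
    have hw : w ∈ ⨆ c : K, maxGenEigenspace (f.restrict hW) c := by
      rw [iSup_maxGenEigenspace_eq_top]; trivial
    refine Submodule.iSup_induction _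
      (motive := fun w : LinearMap.range p ↦ (w : V) ∈ ⨆ c : K, f.maxGenEigenspace c) hw
      (fun c y hy ↦ ?_) (zero_mem _) fun y z hy hz ↦ add_mem hy hz
    rw [maxGenEigenspace, genEigenspace_restrict] at hy
    exact Submodule.mem_iSup_of_mem c hy
  have h2 : x - p x ∈ ⨆ c : K, f.maxGenEigenspace c := by
    refine Submodule.mem_iSup_of_mem 0 ((mem_maxGenEigenspace f 0 _).2 ⟨1, ?_⟩)
    simp [hfp]
  simpa using add_mem (h1 ⟨p x, x, rfl⟩) h2

lemma rank_range_le_of_isIdempotent {K V : Type*} [Field K] [AddCommGroup V] [Module K V]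
    {p q : Module.End K V} (h : ∀ u, p u = u → q u = 0 → u = 0) (hp : ∀ u, p (p u) = p u) :
    Module.rank K (LinearMap.range p) ≤ Module.rank K (LinearMap.range q) := by
  let g : LinearMap.range p →ₗ[K] LinearMap.range q :=
    (q.comp (LinearMap.range p).subtype).codRestrict _ fun x ↦ ⟨x, rfl⟩
  refine LinearMap.rank_le_of_injective g ((injective_iff_map_eq_zero g).2 fun x hx ↦ ?_)
  obtain ⟨_, y, rfl⟩ := x
  exact Subtype.ext (h _ (hp y) (congrArg Subtype.val hx))

/-- On the range the embedding is both compact and a closed embedding, so the unit ball is compact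
and Riesz's theorem applies. -/
lemma finiteDimensional_range_of_norm_le {X Y : Type*} [NormedAddCommGroup X] [NormedSpace ℂ X]
    [CompleteSpace X] [NormedAddCommGroup Y] [NormedSpace ℂ Y] {emb : X →L[ℂ] Y}
    (hemb : IsCompactOperator emb) {p : X →L[ℂ] X} (hp : ∀ u, p (p u) = p u) {D : ℝ}
    (hD : ∀ u, p u = u → ‖u‖ ≤ D * ‖emb u‖) :
    FiniteDimensional ℂ (LinearMap.range (p : X →ₗ[ℂ] X)) := by
  set W := LinearMap.range (p : X →ₗ[ℂ] X) with hW
  have hmem : ∀ u, u ∈ W ↔ p u = u := fun u ↦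
    ⟨fun ⟨v, hv⟩ ↦ by rw [← hv]; exact hp v, fun h ↦ ⟨u, h⟩⟩
  have hclosed : IsClosed (W : Set X) := by
    have : (W : Set X) = {u | p u = u} := Set.ext hmem
    rw [this]
    exact isClosed_eq p.continuous continuous_id
  have : CompleteSpace W := hclosed.completeSpace_coe
  have hanti : AntilipschitzWith D.toNNReal (emb.comp W.subtypeL) :=
    AddMonoidHomClass.antilipschitz_of_bound _ fun u ↦ by
      refine (hD u ((hmem u).1 u.2)).trans ?_
      exact mul_le_mul_of_nonneg_right (Real.le_coe_toNNReal D) (norm_nonneg _)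
  have hce := hanti.isClosedEmbedding (emb.comp W.subtypeL).uniformContinuous
  obtain ⟨K, hK, hKs⟩ := (hemb.comp_clm W.subtypeL).image_closedBall_subset_compact
    (f := ((emb.comp W.subtypeL : W →L[ℂ] Y) : W →ₗ[ℂ] Y)) 1
  refine FiniteDimensional.of_isCompact_closedBall₀ ℂ zero_lt_one
    ((hce.isCompact_preimage hK).of_isClosed_subset Metric.isClosed_closedBall ?_)
  exact fun u hu ↦ hKs ⟨u, hu, rfl⟩

end FiniteRank

/-! ### Riesz projectors of operators whose generalized eigenspaces span. -/

section RieszProjectorEigen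

open Module.End

variable {E : Type*} [NormedAddCommGroup E] [NormedSpace ℂ E] [CompleteSpace E]
  {n : ℕ} {C : Fin n → PiecewiseC1Loop} {A : E →L[ℂ] E}

lemma rieszProjector_apply_of_mem_maxGenEigenspace (h : cycleTrace C ⊆ resolventSet ℂ A) {c : ℂ}
    {u : E} (hu : u ∈ maxGenEigenspace (A : E →ₗ[ℂ] E) c) :
    u = 0 ∨ c ∉ cycleTrace C ∧ rieszProjector C A u = cycleWinding C c • u := by
  obtain ⟨m, hm⟩ := (mem_maxGenEigenspace _ _ _).1 hu
  have hm' : ((A - c • 1) ^ m) u = 0 := by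
    rw [← hm, ← ContinuousLinearMap.coe_coe, ContinuousLinearMap.toLinearMap_pow]
    rfl
  by_cases hc : c ∈ cycleTrace C
  · left
    have hinj : Function.Injective (A - c • 1 : E →L[ℂ] E) := by
      refine (injective_iff_map_eq_zero _).2 fun v hv ↦ ?_
      have hv' : c • v - A v = 0 := by
        have : A v - c • v = 0 := by simpa using hv
        rw [← neg_sub, this, neg_zero]
      rw [← resolvent_apply_smul_sub (h hc) v, hv', map_zero]
    have hinj' : Function.Injective ((A - c • 1 : E →L[ℂ] E) ^ m) := by
      clear hm hm'
      induction m with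
      | zero => exact Function.injective_id
      | succ m ih => rw [pow_succ]; exact ih.comp hinj
    exact hinj' (hm'.trans (map_zero _).symm)
  · exact .inr ⟨hc, rieszProjector_apply_of_genEigen h hc m u hm'⟩

lemma rieszProjector_idempotent_of_iSup_eq_top (h : cycleTrace C ⊆ resolventSet ℂ A)
    (hw : ∀ c ∉ cycleTrace C, cycleWinding C c = 0 ∨ cycleWinding C c = 1)
    (htop : ⨆ c : ℂ, maxGenEigenspace (A : E →ₗ[ℂ] E) c = ⊤) (u : E) :
    rieszProjector C A (rieszProjector C A u) = rieszProjector C A u := by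
  have hu : u ∈ ⨆ c : ℂ, maxGenEigenspace (A : E →ₗ[ℂ] E) c := by rw [htop]; trivial
  refine Submodule.iSup_induction _
    (motive := fun u ↦ rieszProjector C A (rieszProjector C A u) = rieszProjector C A u) hu
    (fun c x hx ↦ ?_) (by simp) fun x y hx hy ↦ by simp only [map_add, hx, hy]
  rcases rieszProjector_apply_of_mem_maxGenEigenspace h hx with rfl | ⟨hc, hP⟩
  · simp
  · rcases hw c hc with h0 | h1
    · simp [hP, h0]
    · simp [hP, h1]

lemma rieszProjector_mem_iSup (h : cycleTrace C ⊆ resolventSet ℂ A) {s : Set ℂ}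
    (hw : ∀ c ∉ cycleTrace C, c ∉ s → cycleWinding C c = 0)
    (htop : ⨆ c : ℂ, maxGenEigenspace (A : E →ₗ[ℂ] E) c = ⊤) (u : E) :
    rieszProjector C A u ∈ ⨆ c ∈ s, maxGenEigenspace (A : E →ₗ[ℂ] E) c := by
  have hu : u ∈ ⨆ c : ℂ, maxGenEigenspace (A : E →ₗ[ℂ] E) c := by rw [htop]; trivial
  refine Submodule.iSup_induction _
    (motive := fun u ↦ rieszProjector C A u ∈ ⨆ c ∈ s, maxGenEigenspace (A : E →ₗ[ℂ] E) c) hu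
    (fun c x hx ↦ ?_) (by simp) fun x y hx hy ↦ by rw [map_add]; exact add_mem hx hy
  rcases rieszProjector_apply_of_mem_maxGenEigenspace h hx with rfl | ⟨hc, hP⟩
  · rw [map_zero]; exact zero_mem _
  · rw [hP]
    by_cases hs : c ∈ s
    · exact Submodule.smul_mem _ _ (Submodule.mem_iSup_of_mem c (Submodule.mem_iSup_of_mem hs hx))
    · rw [hw c hc hs, zero_smul]; exact zero_mem _

end RieszProjectorEigen

namespace IsPiecewiseC1Domain

variable {U : Set ℂ} {n : ℕ} {C : Fin n → PiecewiseC1Loop}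

lemma cycleTrace_eq (h : IsPiecewiseC1Domain U C) : cycleTrace C = frontier U :=
  h.frontier_eq.symm

lemma cycleWinding_eq_zero (h : IsPiecewiseC1Domain U C) {c : ℂ} (hc : c ∉ cycleTrace C)
    (hU : c ∉ U) : cycleWinding C c = 0 := by
  refine h.winding_outside c fun hcl ↦ hc ?_
  rw [h.cycleTrace_eq, h.isOpen.frontier_eq]
  exact ⟨hcl, hU⟩

lemma cycleWinding_eq (h : IsPiecewiseC1Domain U C) {c : ℂ} (hc : c ∉ cycleTrace C) :
    cycleWinding C c = 0 ∨ cycleWinding C c = 1 :=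
  (em (c ∈ U)).elim (fun hU ↦ .inr (h.winding_inside c hU))
    fun hU ↦ .inl (h.cycleWinding_eq_zero hc hU)

end IsPiecewiseC1Domain

/-! ### The discretized operators and their strong and weak resolvents. -/

namespace DFLYGalerkin

variable {Bs Bw : Type*} [NormedAddCommGroup Bs] [NormedSpace ℂ Bs]
    [NormedAddCommGroup Bw] [NormedSpace ℂ Bw] (S : DFLYGalerkin Bs Bw) (k : ℕ)

lemma isDFLY_L : IsDFLY S.emb S.a S.b S.M S.L := ⟨S.strong_bound, S.weak_bound⟩

lemma isDFLY_Lk : IsDFLY S.emb S.a S.b S.M (S.Lk k) := ⟨S.strong_bound_k k, S.weak_bound_k k⟩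

lemma emb_ne_zero {u : Bs} (hu : u ≠ 0) : S.emb u ≠ 0 := fun h ↦
  hu (S.emb_injective (h.trans (map_zero _).symm))

lemma π_π (f : Bw) : S.π k (S.π k f) = S.π k f := DFunLike.congr_fun (S.π_idem k) f

lemma πs_eq_of_emb_mem_range {u : Bs} (hu : S.emb u ∈ Set.range (S.π k)) : S.πs k u = u := by
  obtain ⟨f, hf⟩ := hu
  refine S.emb_injective ?_
  rw [← S.π_emb, ← hf, S.π_π]

lemma πs_πs (u : Bs) : S.πs k (S.πs k u) = S.πs k u :=
  S.πs_eq_of_emb_mem_range k ⟨S.emb u, S.π_emb k u⟩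

lemma Lk_apply (u : Bs) : S.Lk k u = S.πs k (S.L (S.πs k u)) := rfl

lemma LkWeak_apply (f : Bw) : S.LkWeak k f = S.π k (S.Lw (S.π k f)) := rfl

lemma LkWeak_emb (u : Bs) : S.LkWeak k (S.emb u) = S.emb (S.Lk k u) := by
  rw [LkWeak_apply, Lk_apply, S.π_emb, S.Lw_emb, S.π_emb]

instance finiteDimensional_range_πs :
    FiniteDimensional ℂ (LinearMap.range (S.πs k : Bs →ₗ[ℂ] Bs)) := by
  have := S.π_finite k
  let g : LinearMap.range (S.πs k : Bs →ₗ[ℂ] Bs) →ₗ[ℂ] LinearMap.range (S.π k : Bw →ₗ[ℂ] Bw) :=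
    ((S.emb : Bs →ₗ[ℂ] Bw).comp (LinearMap.range (S.πs k : Bs →ₗ[ℂ] Bs)).subtype).codRestrict _ <| by
      rintro ⟨_, x, rfl⟩
      exact ⟨S.emb x, S.π_emb k x⟩
  refine Module.Finite.of_injective g fun x y h ↦ ?_
  exact Subtype.ext (S.emb_injective (congrArg Subtype.val h))

lemma iSup_maxGenEigenspace_Lk :
    ⨆ c : ℂ, Module.End.maxGenEigenspace (S.Lk k : Bs →ₗ[ℂ] Bs) c = ⊤ :=
  iSup_maxGenEigenspace_eq_top_of_isProj (p := (S.πs k : Bs →ₗ[ℂ] Bs))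
    (S.finiteDimensional_range_πs k) (fun x ↦ S.πs_πs k _)
    fun x ↦ by simp [Lk_apply, S.πs_πs]

lemma δ_nonneg : 0 ≤ S.δ k := norm_nonneg _

lemma norm_emb_le_normSW (T : Bs →L[ℂ] Bs) (u : Bs) : ‖S.emb (T u)‖ ≤ S.normSW T * ‖u‖ :=
  (S.emb.comp T).le_opNorm u

lemma norm_emb_Lk_sub_L_le (u : Bs) : ‖S.emb (S.Lk k u - S.L u)‖ ≤ S.δ k * ‖u‖ := by
  rw [map_sub, norm_sub_rev, ← map_sub]
  exact S.norm_emb_le_normSW (S.L - S.Lk k) u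

/-- L - L_k = (1 - π_k) L + π_k L (1 - π_k), and π_k contracts the weak norm. -/
lemma δ_le_ε : S.δ k ≤ S.ε k := by
  refine le_trans ?_ (S.mixed_tail k)
  have h1 : S.emb.comp (S.L - S.Lk k) =
      S.emb.comp ((ContinuousLinearMap.id ℂ Bs - S.πs k).comp S.L) +
        (S.π k).comp (S.emb.comp (S.L.comp (ContinuousLinearMap.id ℂ Bs - S.πs k))) := by
    ext u
    simp [Lk_apply, S.π_emb]
  rw [δ, normSW, h1]
  refine (norm_add_le _ _).trans (add_le_add_right ?_ _)
  exact (ContinuousLinearMap.opNorm_comp_le _ _).trans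
    (mul_le_of_le_one_left (norm_nonneg _) (S.π_norm k))

lemma tendsto_δ : Tendsto S.δ atTop (𝓝 0) :=
  squeeze_zero S.δ_nonneg S.δ_le_ε S.ε_tendsto

lemma norm_le_normEquiv_mul {u : Bs} (hu : S.emb u ∈ Set.range (S.π k)) :
    ‖u‖ ≤ S.normEquiv k * ‖S.emb u‖ := by
  rcases eq_or_ne u 0 with rfl | hu0
  · simp
  have hpos : 0 < ‖S.emb u‖ := norm_pos_iff.2 (S.emb_ne_zero hu0)
  rw [← div_le_iff₀ hpos]
  refine le_csSup ?_ ⟨u, hu, hu0, rfl⟩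
  set W := LinearMap.range (S.πs k : Bs →ₗ[ℂ] Bs)
  obtain ⟨K, -, hK⟩ := (LinearMap.injective_iff_antilipschitz
    ((S.emb : Bs →ₗ[ℂ] Bw).comp W.subtype)).1 (S.emb_injective.comp Subtype.val_injective)
  refine ⟨K, ?_⟩
  rintro _ ⟨v, hv, hv0, rfl⟩
  have hvW : v ∈ W := ⟨v, S.πs_eq_of_emb_mem_range k hv⟩
  rw [div_le_iff₀ (norm_pos_iff.2 (S.emb_ne_zero hv0))]
  simpa using hK.le_mul_dist ⟨v, hvW⟩ 0

lemma normEquiv_nonneg : 0 ≤ S.normEquiv k :=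
  Real.sSup_nonneg <| by rintro _ ⟨u, -, -, rfl⟩; positivity

section Resolvent

variable [CompleteSpace Bs] {k} {z : ℂ}

/-- The lower bound gives injectivity, hence surjectivity on the finite-dimensional range of π_k; on
the kernel of π_k the operator z - L_k is multiplication by z. -/
lemma mem_resolventSet_Lk (hz : z ≠ 0) {K : ℝ} (hK : ∀ u, ‖u‖ ≤ K * ‖z • u - S.Lk k u‖) :
    z ∈ resolventSet ℂ (S.Lk k) := by
  have hinj : ∀ u, z • u - S.Lk k u = 0 → u = 0 := fun u hu ↦ by
    have := hK u
    rw [hu, norm_zero, mul_zero] at this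
    exact norm_le_zero_iff.1 this
  refine mem_resolventSet_of_bijective ⟨fun u v huv ↦ ?_, fun f ↦ ?_⟩
  · refine sub_eq_zero.1 (hinj _ ?_)
    simp only [smul_sub, map_sub] at huv ⊢
    rw [sub_sub_sub_comm, sub_eq_zero]
    exact huv
  set W := LinearMap.range (S.πs k : Bs →ₗ[ℂ] Bs)
  let g : W →ₗ[ℂ] W := (z • (1 : Module.End ℂ Bs) - (S.Lk k : Bs →ₗ[ℂ] Bs)).restrict
    fun x hx ↦ W.sub_mem (W.smul_mem z hx) ⟨_, S.πs_πs k _⟩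
  have hg : Function.Injective g := (injective_iff_map_eq_zero g).2 fun x hx ↦
    Subtype.ext (hinj x (congrArg Subtype.val hx))
  obtain ⟨x, hx⟩ := LinearMap.injective_iff_surjective.1 hg ⟨S.πs k f, f, rfl⟩
  have hx' : z • (x : Bs) - S.Lk k x = S.πs k f := congrArg Subtype.val hx
  refine ⟨x + z⁻¹ • (f - S.πs k f), ?_⟩
  have h0 : S.Lk k (f - S.πs k f) = 0 := by simp [Lk_apply, S.πs_πs]
  simp only [smul_add, map_add, map_smul, h0, smul_zero, add_zero, smul_inv_smul₀ hz]
  rw [add_sub_right_comm, hx']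
  abel

variable {μ : ℝ}

lemma exists_uniform_resolvent_bound (haμ : S.a < μ) (hμM : μ < S.M) {Γ : Set ℂ}
    (hΓ : IsCompact Γ) (hμΓ : ∀ z ∈ Γ, μ ≤ ‖z‖) (hΓL : Γ ⊆ resolventSet ℂ S.L) :
    ∃ K, 0 ≤ K ∧ (∀ z ∈ Γ, ‖resolvent S.L z‖ ≤ K) ∧ ∀ᶠ k in atTop,
      Γ ⊆ resolventSet ℂ (S.Lk k) ∧ ∀ z ∈ Γ, ‖resolvent (S.Lk k) z‖ ≤ K := by
  obtain ⟨K, hK0, hK⟩ := exists_norm_resolvent_le S.L hΓ hΓL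
  obtain ⟨η, hη, K', hK'0, hK'⟩ := S.isDFLY_L.exists_norm_le_of_mixed_close S.a_pos S.b_pos haμ hμM
    hΓL hμΓ hK0.le hK
  refine ⟨max K K', hK0.le.trans (le_max_left _ _), fun z hz ↦ (hK z hz).trans (le_max_left _ _), ?_⟩
  filter_upwards [S.tendsto_δ.eventually_le_const hη] with k hk
  have hlow := hK' (S.Lk k) (S.isDFLY_Lk k) fun u ↦ (S.norm_emb_Lk_sub_L_le k u).trans
    (mul_le_mul_of_nonneg_right hk (norm_nonneg _))
  have hmem : Γ ⊆ resolventSet ℂ (S.Lk k) := fun z hz ↦ by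
    refine S.mem_resolventSet_Lk (fun h0 ↦ ?_) (hlow z hz)
    have := hμΓ z hz
    rw [h0, norm_zero] at this
    linarith [S.a_pos]
  exact ⟨hmem, fun z hz ↦ (norm_resolvent_le_of_lower_bound (hmem hz) hK'0.le (hlow z hz)).trans
    (le_max_right _ _)⟩

end Resolvent

section WeakResolvent

variable {k} {z : ℂ}

lemma smul_sub_LkWeak_apply (hz0 : z ≠ 0) (hz : z ∈ resolventSet ℂ (S.Lk k)) {g : Bw} {x : Bs}
    (hx : S.emb x = S.π k g) :
    z • (z⁻¹ • (g - S.π k g) + S.emb (resolvent (S.Lk k) z x)) -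
      S.LkWeak k (z⁻¹ • (g - S.π k g) + S.emb (resolvent (S.Lk k) z x)) = g := by
  have h0 : S.LkWeak k (g - S.π k g) = 0 := by simp [LkWeak_apply, S.π_π]
  have h1 := congrArg S.emb (smul_resolvent_apply_sub hz x)
  rw [map_sub, map_smul, hx] at h1
  simp only [smul_add, map_add, map_smul, h0, smul_zero, zero_add, smul_inv_smul₀ hz0, LkWeak_emb]
  rw [add_sub_assoc, h1]
  abel

variable [CompleteSpace Bw]

/-- A weak kernel vector of z - L_k lies in the range of π_k because z ≠ 0, hence comes from the
strong space, where the resolvent kills it. Surjectivity is an explicit formula. -/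
lemma mem_resolventSet_LkWeak (hz0 : z ≠ 0) (hz : z ∈ resolventSet ℂ (S.Lk k)) :
    z ∈ resolventSet ℂ (S.LkWeak k) := by
  refine mem_resolventSet_of_bijective ⟨fun u v huv ↦ ?_, fun g ↦ ?_⟩
  · have hw : z • (u - v) = S.π k (S.Lw (S.π k (u - v))) := by
      rw [← LkWeak_apply, ← sub_eq_zero, smul_sub, map_sub, sub_sub_sub_comm, sub_eq_zero]
      exact huv
    obtain ⟨x, hx⟩ := S.π_range k (S.Lw (S.π k (u - v)))
    have hx' : u - v = S.emb (z⁻¹ • x) := by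
      rw [map_smul, hx, ← hw, inv_smul_smul₀ hz0]
    have h2 : z • (z⁻¹ • x) - S.Lk k (z⁻¹ • x) = 0 := by
      refine S.emb_injective ?_
      rw [map_sub, map_smul, ← LkWeak_emb, ← hx', hw, LkWeak_apply, sub_self, map_zero]
    have h3 := resolvent_apply_smul_sub hz (z⁻¹ • x)
    rw [h2, map_zero] at h3
    rw [← sub_eq_zero, hx', ← h3, map_zero]
  · obtain ⟨x, hx⟩ := S.π_range k g
    exact ⟨_, S.smul_sub_LkWeak_apply hz0 hz hx⟩

lemma norm_resolvent_LkWeak_le {μ : ℝ} (haμ : S.a < μ) (hμM : μ < S.M) (hμz : μ ≤ ‖z‖)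
    (hz : z ∈ resolventSet ℂ (S.Lk k)) {K : ℝ} (hK : ‖resolvent (S.Lk k) z‖ ≤ K) (n : ℕ) :
    ‖resolvent (S.LkWeak k) z‖ ≤ 2 / μ + IsDFLY.resolventConst S.emb S.a S.b S.M μ K *
      ((S.a / μ) ^ n * S.normEquiv k + (S.M / μ) ^ n) := by
  have hμ : 0 < μ := S.a_pos.trans haμ
  have hM := S.M_pos
  have ha := S.a_pos
  have hE := S.normEquiv_nonneg k
  have hz0 : z ≠ 0 := fun h0 ↦ by rw [h0, norm_zero] at hμz; linarith
  have hc : 0 ≤ IsDFLY.resolventConst S.emb S.a S.b S.M μ K :=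
    IsDFLY.resolventConst_nonneg S.b_pos haμ hμM ((norm_nonneg _).trans hK)
  refine ContinuousLinearMap.opNorm_le_bound _ (by positivity) fun g ↦ ?_
  obtain ⟨x, hx⟩ := S.π_range k g
  have hπ : ‖S.π k g‖ ≤ ‖g‖ := ((S.π k).le_opNorm g).trans
    (mul_le_of_le_one_left (norm_nonneg _) (S.π_norm k))
  rw [resolvent_apply_eq_of (S.mem_resolventSet_LkWeak hz0 hz) (S.smul_sub_LkWeak_apply hz0 hz hx)]
  have h1 : ‖z⁻¹ • (g - S.π k g)‖ ≤ 2 / μ * ‖g‖ := by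
    rw [norm_smul, norm_inv]
    calc ‖z‖⁻¹ * ‖g - S.π k g‖ ≤ μ⁻¹ * (‖g‖ + ‖g‖) := by
          gcongr
          exact (norm_sub_le _ _).trans (by gcongr)
      _ = _ := by ring
  have h2 := (S.isDFLY_Lk k).norm_emb_resolvent_le S.a_pos S.b_pos haμ hμM hz hμz hK n x
  have h3 : ‖x‖ ≤ S.normEquiv k * ‖g‖ :=
    (S.norm_le_normEquiv_mul k ⟨g, hx.symm⟩).trans (by rw [hx]; gcongr)
  have h4 : ‖S.emb x‖ ≤ ‖g‖ := hx ▸ hπ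
  calc _ ≤ 2 / μ * ‖g‖ + IsDFLY.resolventConst S.emb S.a S.b S.M μ K *
        ((S.a / μ) ^ n * (S.normEquiv k * ‖g‖) + (S.M / μ) ^ n * ‖g‖) :=
        (norm_add_le _ _).trans (add_le_add h1 (h2.trans (by gcongr)))
    _ = _ := by ring

end WeakResolvent

/-- For E > 1 take n = ⌈log E / log(M/a)⌉: then E ≤ (M/a)^n, so the first term is below the second,
and rounding up costs one factor M/μ. For E ≤ 1 take n = 0. -/
lemma exists_pow_balance {a μ M E : ℝ} (ha : 0 < a) (haμ : a < μ) (hμM : μ < M) (hE : 0 ≤ E) :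
    ∃ n : ℕ, (a / μ) ^ n * E + (M / μ) ^ n ≤
      2 * (M / μ) * (1 + E ^ (|Real.log (μ / M)| / |Real.log (a / M)|)) := by
  have hμ : 0 < μ := ha.trans haμ
  have hM : 0 < M := hμ.trans hμM
  have hMμ : 1 < M / μ := (one_lt_div hμ).2 hμM
  have hMa : 1 < M / a := (one_lt_div ha).2 (haμ.trans hμM)
  rcases le_or_gt E 1 with h1 | h1
  · refine ⟨0, ?_⟩
    have : 0 ≤ E ^ (|Real.log (μ / M)| / |Real.log (a / M)|) := Real.rpow_nonneg hE _
    simp only [pow_zero, one_mul]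
    nlinarith
  have hlog : ∀ x : ℝ, 0 < x → x < M → |Real.log (x / M)| = Real.log (M / x) := fun x hx hxM ↦ by
    rw [← inv_div, Real.log_inv, abs_neg, abs_of_pos (Real.log_pos ((one_lt_div hx).2 hxM))]
  rw [hlog μ hμ hμM, hlog a ha (haμ.trans hμM)]
  have hla : 0 < Real.log (M / a) := Real.log_pos hMa
  have hE0 : 0 < E := by linarith
  set t := Real.log E / Real.log (M / a) with ht
  have ht0 : 0 ≤ t := div_nonneg (Real.log_nonneg h1.le) hla.le
  refine ⟨⌈t⌉₊, ?_⟩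
  have hEn : E ≤ (M / a) ^ ⌈t⌉₊ := by
    rw [← Real.log_le_log_iff hE0 (by positivity), Real.log_pow, ← div_le_iff₀ hla]
    exact Nat.le_ceil t
  have h2 : (a / μ) ^ ⌈t⌉₊ * E ≤ (M / μ) ^ ⌈t⌉₊ := by
    calc (a / μ) ^ ⌈t⌉₊ * E ≤ (a / μ) ^ ⌈t⌉₊ * (M / a) ^ ⌈t⌉₊ := by gcongr
      _ = _ := by rw [← mul_pow]; congr 1; field_simp
  have h3 : (M / μ) ^ ⌈t⌉₊ ≤ (M / μ) * E ^ (Real.log (M / μ) / Real.log (M / a)) := by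
    calc (M / μ) ^ ⌈t⌉₊ = (M / μ) ^ (⌈t⌉₊ : ℝ) := (Real.rpow_natCast _ _).symm
      _ ≤ (M / μ) ^ (t + 1) :=
          Real.rpow_le_rpow_of_exponent_le hMμ.le (Nat.ceil_lt_add_one ht0).le
      _ = (M / μ) * (M / μ) ^ t := by rw [Real.rpow_add_one (by positivity), mul_comm]
      _ = _ := by
          congr 1
          rw [Real.rpow_def_of_pos (by positivity), Real.rpow_def_of_pos hE0, ht]
          congr 1
          ring
  have h4 : 0 < M / μ := by positivity
  linarith

end DFLYGalerkin

/-! ### Spectral windows, convergence of Riesz projectors and equality of ranks. -/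

namespace DFLYGalerkin

variable {Bs Bw : Type*} [NormedAddCommGroup Bs] [NormedSpace ℂ Bs] [CompleteSpace Bs]
    [NormedAddCommGroup Bw] [NormedSpace ℂ Bw] [CompleteSpace Bw] (S : DFLYGalerkin Bs Bw)
    {μ : ℝ}

omit [CompleteSpace Bs] in
lemma tendsto_weak_resolvent_bound (haμ : S.a < μ) (hμM : μ < S.M)
    (hrate : Tendsto (fun k => S.δ k * S.normEquiv k ^ S.exponent μ) atTop (𝓝 0))
    {K : ℝ} (hK0 : 0 ≤ K) {η : ℝ} (hη : 0 < η) :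
    ∀ᶠ k in atTop, ∀ z ∈ resolventSet ℂ (S.Lk k), μ ≤ ‖z‖ → ‖resolvent (S.Lk k) z‖ ≤ K →
      S.b * S.δ k * ‖resolvent (S.LkWeak k) z‖ ≤ η := by
  set c := IsDFLY.resolventConst S.emb S.a S.b S.M μ K
  have hc : 0 ≤ c := IsDFLY.resolventConst_nonneg S.b_pos haμ hμM hK0
  have hlim : Tendsto (fun k ↦ (S.b * (2 / μ) + S.b * c * (2 * (S.M / μ))) * S.δ k +
      S.b * c * (2 * (S.M / μ)) * (S.δ k * S.normEquiv k ^ S.exponent μ)) atTop (𝓝 0) := by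
    simpa using (S.tendsto_δ.const_mul (S.b * (2 / μ) + S.b * c * (2 * (S.M / μ)))).add
      (hrate.const_mul (S.b * c * (2 * (S.M / μ))))
  filter_upwards [hlim.eventually_le_const hη] with k hk z hz hμz hK
  obtain ⟨n, hn⟩ := exists_pow_balance S.a_pos haμ hμM (S.normEquiv_nonneg k)
  have h1 := S.norm_resolvent_LkWeak_le haμ hμM hμz hz hK n
  have h2 : ‖resolvent (S.LkWeak k) z‖ ≤
      2 / μ + c * (2 * (S.M / μ) * (1 + S.normEquiv k ^ S.exponent μ)) :=
    h1.trans (by gcongr; exact hn)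
  refine (mul_le_mul_of_nonneg_left h2 (mul_nonneg S.b_pos.le (S.δ_nonneg k))).trans ?_
  refine le_trans (le_of_eq ?_) hk
  ring

omit [CompleteSpace Bs] [CompleteSpace Bw] in
lemma tendsto_norm_emb_resolvent_sub (haμ : S.a < μ) (hμM : μ < S.M) {Γ : Set ℂ}
    (hμΓ : ∀ z ∈ Γ, μ ≤ ‖z‖) (hΓL : Γ ⊆ resolventSet ℂ S.L) {K : ℝ} (hK0 : 0 ≤ K)
    (hKL : ∀ z ∈ Γ, ‖resolvent S.L z‖ ≤ K)
    (hK : ∀ᶠ k in atTop, Γ ⊆ resolventSet ℂ (S.Lk k) ∧ ∀ z ∈ Γ, ‖resolvent (S.Lk k) z‖ ≤ K)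
    {η : ℝ} (hη : 0 < η) :
    ∀ᶠ k in atTop, ∀ z ∈ Γ, ∀ u,
      ‖S.emb (resolvent (S.Lk k) z u) - S.emb (resolvent S.L z u)‖ ≤ η * ‖u‖ := by
  set N := 2 * (S.a + S.b * ‖S.emb‖) with hN
  have hN0 : 0 ≤ N := by have := S.a_pos; have := S.b_pos; positivity
  obtain ⟨D, hD0, hD⟩ := IsDFLY.exists_norm_emb_resolvent_le S.emb S.a_pos S.b_pos haμ hμM hK0
    (show 0 < η / (2 * (K * N + 1)) by positivity)
  filter_upwards [hK, S.tendsto_δ.eventually_le_const (show 0 < η / (2 * (K * D + 1)) by positivity)]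
    with k ⟨hk1, hk2⟩ hδ z hz u
  rw [← map_sub, resolvent_sub_resolvent_apply (hΓL hz) (hk1 hz)]
  set v := resolvent (S.Lk k) z u
  have hv : ‖v‖ ≤ K * ‖u‖ := ((resolvent (S.Lk k) z).le_opNorm u).trans
    (mul_le_mul_of_nonneg_right (hk2 z hz) (norm_nonneg u))
  have h1 := hD S.L S.isDFLY_L z (hΓL hz) (hμΓ z hz) (hKL z hz) ((S.Lk k - S.L) v)
  have h2 : ‖(S.Lk k - S.L) v‖ ≤ N * ‖v‖ := by
    have := norm_sub_le (S.Lk k v) (S.L v)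
    have := (S.isDFLY_Lk k).norm_apply_le S.b_pos v
    have := S.isDFLY_L.norm_apply_le S.b_pos v
    rw [sub_apply, hN]
    linarith
  have h3 : ‖S.emb ((S.Lk k - S.L) v)‖ ≤ η / (2 * (K * D + 1)) * ‖v‖ :=
    (S.norm_emb_Lk_sub_L_le k v).trans (mul_le_mul_of_nonneg_right hδ (norm_nonneg v))
  calc _ ≤ η / (2 * (K * N + 1)) * (N * (K * ‖u‖)) +
        D * (η / (2 * (K * D + 1)) * (K * ‖u‖)) := by
        refine h1.trans (add_le_add ?_ ?_)
        · exact mul_le_mul_of_nonneg_left (h2.trans (by gcongr)) (by positivity)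
        · exact mul_le_mul_of_nonneg_left (h3.trans (by gcongr)) hD0.le
    _ = (K * N / (K * N + 1) + K * D / (K * D + 1)) * (η / 2) * ‖u‖ := by field_simp
    _ ≤ (1 + 1) * (η / 2) * ‖u‖ := by
        gcongr
        · exact (div_le_one (by positivity)).2 (by linarith)
        · exact (div_le_one (by positivity)).2 (by linarith)
    _ = _ := by ring

variable {n : ℕ} {C : Fin n → PiecewiseC1Loop}

lemma tendsto_normSW_rieszProjector_sub (haμ : S.a < μ) (hμM : μ < S.M)
    (hμC : ∀ z ∈ cycleTrace C, μ ≤ ‖z‖) (hCL : cycleTrace C ⊆ resolventSet ℂ S.L) :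
    Tendsto (fun k ↦ S.normSW (rieszProjector C (S.Lk k) - rieszProjector C S.L)) atTop (𝓝 0) := by
  obtain ⟨K, hK0, hKL, hK⟩ :=
    S.exists_uniform_resolvent_bound haμ hμM (isCompact_cycleTrace C) hμC hCL
  have hl := cycleLength_nonneg C
  refine (tendsto_order.2 ⟨fun η hη ↦ Eventually.of_forall fun k ↦ hη.trans_le (norm_nonneg _),
    fun η hη ↦ ?_⟩)
  filter_upwards [hK, S.tendsto_norm_emb_resolvent_sub haμ hμM hμC hCL hK0 hKL hK
    (show 0 < η / (2 * (cycleLength C + 1)) by positivity)] with k hk hkη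
  refine lt_of_le_of_lt (ContinuousLinearMap.opNorm_le_bound _ (half_pos hη).le fun u ↦ ?_)
    (half_lt_self hη)
  have hc : ∀ {A : Bs →L[ℂ] Bs}, cycleTrace C ⊆ resolventSet ℂ A →
      ContinuousOn (fun z ↦ S.emb (resolvent A z u)) (cycleTrace C) := fun hA ↦
    S.emb.continuous.comp_continuousOn (continuousOn_resolvent_apply hA u)
  rw [ContinuousLinearMap.comp_apply, sub_apply, map_sub, clm_rieszProjector_apply hk.1,
    clm_rieszProjector_apply hCL, ← smul_sub, ← cycleIntegral_sub (hc hk.1) (hc hCL)]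
  refine (norm_two_pi_I_inv_smul_cycleIntegral_le fun z hz ↦ hkη z hz u).trans ?_
  calc _ = cycleLength C / (cycleLength C + 1) * (η / 2) * ‖u‖ := by field_simp
    _ ≤ 1 * (η / 2) * ‖u‖ := by
        gcongr
        exact (div_le_one (by positivity)).2 (by linarith)
    _ = _ := by ring

omit [CompleteSpace Bs] [CompleteSpace Bw] in
lemma tendsto_emb_apply {T : ℕ → Bs →L[ℂ] Bs} {T₀ : Bs →L[ℂ] Bs}
    (h : Tendsto (fun k ↦ S.normSW (T k - T₀)) atTop (𝓝 0)) (u : Bs) :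
    Tendsto (fun k ↦ S.emb (T k u)) atTop (𝓝 (S.emb (T₀ u))) := by
  rw [tendsto_iff_norm_sub_tendsto_zero]
  refine squeeze_zero (fun _ ↦ norm_nonneg _) (fun k ↦ ?_)
    (by simpa using h.mul_const ‖u‖)
  rw [← map_sub]
  exact S.norm_emb_le_normSW (T k - T₀) u

lemma rieszProjector_idempotent (haμ : S.a < μ) (hμM : μ < S.M)
    (hμC : ∀ z ∈ cycleTrace C, μ ≤ ‖z‖) (hCL : cycleTrace C ⊆ resolventSet ℂ S.L)
    (hw : ∀ c ∉ cycleTrace C, cycleWinding C c = 0 ∨ cycleWinding C c = 1) (u : Bs) :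
    rieszProjector C S.L (rieszProjector C S.L u) = rieszProjector C S.L u := by
  obtain ⟨K, hK0, hKL, hK⟩ :=
    S.exists_uniform_resolvent_bound haμ hμM (isCompact_cycleTrace C) hμC hCL
  have hl := cycleLength_nonneg C
  set l := cycleLength C
  set P := rieszProjector C S.L
  set Pk := fun k ↦ rieszProjector C (S.Lk k)
  have hP := S.tendsto_normSW_rieszProjector_sub haμ hμM hμC hCL
  have hlim := S.tendsto_emb_apply hP
  have hbound : ∀ {A : Bs →L[ℂ] Bs}, cycleTrace C ⊆ resolventSet ℂ A →
      (∀ z ∈ cycleTrace C, ‖resolvent A z‖ ≤ K) → ‖rieszProjector C A u‖ ≤ l * (K * ‖u‖) :=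
    fun {A} hA hAK ↦ norm_clm_rieszProjector_apply_le hA (ContinuousLinearMap.id ℂ Bs) u
      fun z hz ↦ ((resolvent A z).le_opNorm u).trans
        (mul_le_mul_of_nonneg_right (hAK z hz) (norm_nonneg u))
  -- The difference is bounded in the strong norm and tends to 0 in the weak norm only; the mixed
  -- resolvent bound, uniform in k, shows that applying the projector of L_k preserves weak
  -- smallness.
  have hzero : Tendsto (fun k ↦ S.emb (Pk k (Pk k u - P u))) atTop (𝓝 0) := by
    rw [Metric.tendsto_nhds]
    intro η hη
    set B := 2 * (l * (K * ‖u‖)) with hB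
    have hB0 : 0 ≤ B := by positivity
    obtain ⟨D, hD0, hD⟩ := IsDFLY.exists_norm_emb_resolvent_le S.emb S.a_pos S.b_pos haμ hμM hK0
      (show 0 < η / (3 * (l * B + 1)) by positivity)
    have hsmall : ∀ᶠ k in atTop, ‖S.emb (Pk k u) - S.emb (P u)‖ ≤ η / (3 * (l * D + 1)) :=
      (tendsto_iff_norm_sub_tendsto_zero.1 (hlim u)).eventually_le_const (by positivity)
    filter_upwards [hK, hsmall] with k hk hks
    rw [dist_zero_right]
    have hg : ‖Pk k u - P u‖ ≤ B := (norm_sub_le _ _).trans (by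
      rw [hB]; linarith [hbound hk.1 hk.2, hbound hCL hKL])
    have h1 := norm_clm_rieszProjector_apply_le hk.1 S.emb (Pk k u - P u) fun z hz ↦
      hD (S.Lk k) (S.isDFLY_Lk k) z (hk.1 hz) (hμC z hz) (hk.2 z hz) (Pk k u - P u)
    refine h1.trans_lt ?_
    rw [map_sub]
    calc _ ≤ l * (η / (3 * (l * B + 1)) * B + D * (η / (3 * (l * D + 1)))) := by gcongr
      _ = (l * B / (l * B + 1) + l * D / (l * D + 1)) * (η / 3) := by field_simp
      _ ≤ (1 + 1) * (η / 3) := by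
          gcongr
          · exact (div_le_one (by positivity)).2 (by linarith)
          · exact (div_le_one (by positivity)).2 (by linarith)
      _ < η := by linarith
  have h2 : Tendsto (fun k ↦ S.emb (Pk k (Pk k u))) atTop (𝓝 (S.emb (P (P u)))) := by
    have := hzero.add (hlim (P u))
    rw [zero_add] at this
    refine this.congr fun k ↦ ?_
    rw [map_sub, map_sub, sub_add_cancel]
  have h3 : (fun k ↦ S.emb (Pk k (Pk k u))) =ᶠ[atTop] fun k ↦ S.emb (Pk k u) := by
    filter_upwards [hK] with k hk
    exact congrArg S.emb (rieszProjector_idempotent_of_iSup_eq_top hk.1 hw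
      (S.iSup_maxGenEigenspace_Lk k) u)
  exact S.emb_injective (tendsto_nhds_unique (h2.congr' h3) (hlim u))

lemma eventually_rank_range_rieszProjector_eq (haμ : S.a < μ) (hμM : μ < S.M)
    (hμC : ∀ z ∈ cycleTrace C, μ ≤ ‖z‖) (hCL : cycleTrace C ⊆ resolventSet ℂ S.L)
    (hw : ∀ c ∉ cycleTrace C, cycleWinding C c = 0 ∨ cycleWinding C c = 1) :
    ∀ᶠ k in atTop, Module.rank ℂ (LinearMap.range (rieszProjector C (S.Lk k) : Bs →ₗ[ℂ] Bs)) =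
      Module.rank ℂ (LinearMap.range (rieszProjector C S.L : Bs →ₗ[ℂ] Bs)) := by
  obtain ⟨K, hK0, hKL, hK⟩ :=
    S.exists_uniform_resolvent_bound haμ hμM (isCompact_cycleTrace C) hμC hCL
  obtain ⟨D, hD0, hD⟩ := IsDFLY.exists_norm_le_of_winding S.emb S.a_pos S.b_pos haμ hμM C hμC hK0
  have h0 : (0 : ℂ) ∉ cycleTrace C := fun h ↦ by
    have := hμC 0 h
    rw [norm_zero] at this
    linarith [S.a_pos]
  filter_upwards [hK, (S.tendsto_normSW_rieszProjector_sub haμ hμM hμC hCL).eventually_lt_const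
    (inv_pos.2 hD0)] with k hk hkD
  set P := rieszProjector C S.L
  set Q := rieszProjector C (S.Lk k)
  have hDP : ∀ u, ‖u‖ = ‖P u - cycleWinding C 0 • u‖ → ‖u‖ ≤ D * ‖S.emb u‖ :=
    hD S.L S.isDFLY_L hCL hKL
  have hDQ : ∀ u, ‖u‖ = ‖Q u - cycleWinding C 0 • u‖ → ‖u‖ ≤ D * ‖S.emb u‖ :=
    hD (S.Lk k) (S.isDFLY_Lk k) hk.1 hk.2
  have key : ∀ u, ‖u‖ ≤ D * ‖S.emb u‖ → ‖S.emb u‖ = ‖S.emb ((Q - P) u)‖ → u = 0 := by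
    intro u h1 h2
    have h3 := S.norm_emb_le_normSW (Q - P) u
    by_contra hu
    have hpos := norm_pos_iff.2 hu
    have h4 : S.normSW (Q - P) * ‖u‖ < D⁻¹ * ‖u‖ := mul_lt_mul_of_pos_right hkD hpos
    have h5 : D * ‖S.emb u‖ < D * (D⁻¹ * ‖u‖) :=
      mul_lt_mul_of_pos_left ((h2.trans_le h3).trans_lt h4) hD0
    rw [mul_inv_cancel_left₀ hD0.ne'] at h5
    exact absurd h1 (not_le.2 h5)
  have hPQ : ∀ u, P u = u → Q u = 0 → u = 0 := by
    intro u hPu hQu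
    refine key u ?_ (by simp [hPu, hQu])
    -- Winding 0 about the origin uses the projector that fixes u; winding 1 uses the one that
    -- annihilates it.
    rcases hw 0 h0 with h | h
    · exact hDP u (by simp [hPu, h])
    · exact hDQ u (by simp [hQu, h])
  have hQP : ∀ u, Q u = u → P u = 0 → u = 0 := by
    intro u hQu hPu
    refine key u ?_ (by simp [hPu, hQu])
    rcases hw 0 h0 with h | h
    · exact hDQ u (by simp [hQu, h])
    · exact hDP u (by simp [hPu, h])
  exact le_antisymm
    (rank_range_le_of_isIdempotent (p := (Q : Bs →ₗ[ℂ] Bs)) hQP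
      (rieszProjector_idempotent_of_iSup_eq_top hk.1 hw (S.iSup_maxGenEigenspace_Lk k)))
    (rank_range_le_of_isIdempotent (p := (P : Bs →ₗ[ℂ] Bs)) hPQ
      (S.rieszProjector_idempotent haμ hμM hμC hCL hw))

lemma eventually_spectral_window (haμ : S.a < μ) (hμM : μ < S.M)
    (hrate : Tendsto (fun k => S.δ k * S.normEquiv k ^ S.exponent μ) atTop (𝓝 0))
    {Γ : Set ℂ} (hΓ : IsCompact Γ) (hμΓ : ∀ z ∈ Γ, μ ≤ ‖z‖) (hΓL : Γ ⊆ resolventSet ℂ S.L) :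
    ∀ᶠ k in atTop, Γ ⊆ resolventSet ℂ (S.Lk k) ∧ Γ ⊆ resolventSet ℂ (S.LkWeak k) ∧
      (⨆ z ∈ Γ, ENNReal.ofReal (S.b * S.δ k) * resolventNorm (S.LkWeak k) z) <
        ⨅ z ∈ Γ, ENNReal.ofReal (‖z‖ - S.a) := by
  obtain ⟨K, hK0, -, hK⟩ := S.exists_uniform_resolvent_bound haμ hμM hΓ hμΓ hΓL
  have hd : 0 < μ - S.a := sub_pos.2 haμ
  filter_upwards [hK, S.tendsto_weak_resolvent_bound haμ hμM hrate hK0 (half_pos hd)] with k hk hkη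
  have hne : ∀ z ∈ Γ, z ≠ 0 := fun z hz h0 ↦ by
    have := hμΓ z hz
    rw [h0, norm_zero] at this
    linarith [S.a_pos]
  have hweak : Γ ⊆ resolventSet ℂ (S.LkWeak k) := fun z hz ↦
    S.mem_resolventSet_LkWeak (hne z hz) (hk.1 hz)
  refine ⟨hk.1, hweak, ?_⟩
  calc _ ≤ ENNReal.ofReal ((μ - S.a) / 2) := by
        refine iSup₂_le fun z hz ↦ ?_
        rw [resolventNorm, if_pos (hweak hz), ← ofReal_norm,
          ← ENNReal.ofReal_mul (mul_nonneg S.b_pos.le (S.δ_nonneg k))]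
        exact ENNReal.ofReal_le_ofReal (hkη z (hk.1 hz) (hμΓ z hz) (hk.2 z hz))
    _ < ENNReal.ofReal (μ - S.a) := (ENNReal.ofReal_lt_ofReal_iff hd).2 (half_lt_self hd)
    _ ≤ _ := le_iInf₂ fun z hz ↦ ENNReal.ofReal_le_ofReal (by linarith [hμΓ z hz])

end DFLYGalerkin

/-! ### Isolation of spectrum by an analytic determinant. -/

section IsolatedSpectrum

variable {E W : Type*} [NormedAddCommGroup E] [NormedSpace ℂ E] [CompleteSpace E]
  [NormedAddCommGroup W] [NormedSpace ℂ W] [FiniteDimensional ℂ W]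

lemma differentiableOn_matrix_det {ι : Type*} [Fintype ι] [DecidableEq ι] {U : Set ℂ}
    {M : ℂ → Matrix ι ι ℂ} (h : ∀ i j, DifferentiableOn ℂ (fun t ↦ M t i j) U) :
    DifferentiableOn ℂ (fun t ↦ (M t).det) U := by
  simp only [Matrix.det_apply]
  fun_prop

/-- With V = (1 - tT)⁻¹, invertibility of 1 - t(T + JG) reduces to that of 1 - tGVJ on the
finite-dimensional space. Its determinant is analytic on the disc |t| < 1/R and equals 1 at t = 0,
so its zeros are isolated. -/
lemma eventually_inv_mem_resolventSet_add_comp (T : E →L[ℂ] E) (G : E →L[ℂ] W) (J : W →L[ℂ] E)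
    {R : ℝ} (hT : ‖T‖ < R) {t₀ : ℂ} (ht₀ : ‖t₀‖ < R⁻¹) :
    ∀ᶠ t in 𝓝[≠] t₀, t ≠ 0 → t⁻¹ ∈ resolventSet ℂ (T + J.comp G) := by
  have hR : 0 < R := (norm_nonneg T).trans_lt hT
  have hmemB : ∀ {t : ℂ}, t ∈ Metric.ball (0 : ℂ) R⁻¹ ↔ ‖t‖ < R⁻¹ := by simp
  have hunit : ∀ t ∈ Metric.ball (0 : ℂ) R⁻¹, IsUnit (1 - t • T) := fun t ht ↦ by
    refine isUnit_one_sub_of_norm_lt_one ?_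
    rw [norm_smul]
    calc ‖t‖ * ‖T‖ ≤ ‖t‖ * R := by gcongr
      _ < R⁻¹ * R := by gcongr; exact hmemB.1 ht
      _ = 1 := inv_mul_cancel₀ hR.ne'
  let V : ℂ → E →L[ℂ] E := fun t ↦ Ring.inverse (1 - t • T)
  have hV : ∀ t ∈ Metric.ball (0 : ℂ) R⁻¹, DifferentiableAt ℂ V t := fun t ht ↦
    DifferentiableAt.comp (g := Ring.inverse) (f := fun t : ℂ ↦ 1 - t • T) t
      (differentiableAt_inverse (hunit t ht)) (by fun_prop)
  let N : ℂ → W →ₗ[ℂ] W := fun t ↦ 1 - t • (G.comp ((V t).comp J) : W →ₗ[ℂ] W)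
  let β := Module.finBasis ℂ W
  let h : ℂ → ℂ := fun t ↦ LinearMap.det (N t)
  have hdet : ∀ t, h t = (LinearMap.toMatrix β β (N t)).det := fun t ↦
    (LinearMap.det_toMatrix β (N t)).symm
  have hdiff : DifferentiableOn ℂ h (Metric.ball 0 R⁻¹) := by
    rw [show h = _ from funext hdet]
    refine differentiableOn_matrix_det fun i j ↦ ?_
    have hentry : (fun t ↦ LinearMap.toMatrix β β (N t) i j) = fun t ↦
        (LinearMap.toContinuousLinearMap (β.coord i)) (β j - t • G (V t (J (β j)))) := by
      funext t
      simp [LinearMap.toMatrix_apply, N]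
    rw [hentry]
    intro t ht
    have hVt := hV t ht
    refine DifferentiableAt.differentiableWithinAt ?_
    have : DifferentiableAt ℂ (fun t ↦ V t (J (β j))) t := hVt.clm_apply (by fun_prop)
    fun_prop
  have hne : ∀ᶠ t in 𝓝[≠] t₀, h t ≠ 0 := by
    rcases ((hdiff.analyticOnNhd Metric.isOpen_ball) t₀
      (hmemB.2 ht₀)).eventually_eq_zero_or_eventually_ne_zero with h0 | h0
    · have := (hdiff.analyticOnNhd Metric.isOpen_ball).eqOn_zero_of_preconnected_of_eventuallyEq_zero
        (convex_ball (0 : ℂ) R⁻¹).isPreconnected (hmemB.2 ht₀) h0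
      have h1 := this (Metric.mem_ball_self (inv_pos.2 hR))
      simp [h, N] at h1
    · exact h0
  have hball : ∀ᶠ t in 𝓝[≠] t₀, t ∈ Metric.ball (0 : ℂ) R⁻¹ :=
    mem_nhdsWithin_of_mem_nhds (Metric.isOpen_ball.mem_nhds (hmemB.2 ht₀))
  filter_upwards [hne, hball] with t htdet htb ht0
  have hbij : Function.Bijective (N t) :=
    (LinearMap.equivOfDetNeZero (N t) htdet).bijective
  have hVl : ∀ u, V t (u - t • T u) = u := fun u ↦
    by simpa using DFunLike.congr_fun (Ring.inverse_mul_cancel _ (hunit t htb)) u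
  have hVr : ∀ u, V t u - t • T (V t u) = u := fun u ↦
    by simpa using DFunLike.congr_fun (Ring.mul_inverse_cancel _ (hunit t htb)) u
  have hN : ∀ y, N t y = y - t • G (V t (J y)) := fun y ↦ rfl
  refine mem_resolventSet_of_bijective ⟨?_, fun f ↦ ?_⟩
  · refine (injective_iff_map_eq_zero (t⁻¹ • (1 : E →L[ℂ] E) - (T + J.comp G))).2 fun u hu ↦ ?_
    have h1 : t⁻¹ • u = T u + J (G u) := by
      rw [← sub_eq_zero]; simpa using hu
    have h2 : u - t • T u = t • J (G u) := by
      rw [sub_eq_iff_eq_add, ← smul_add, add_comm, ← h1, smul_inv_smul₀ ht0]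
    have h3 : u = t • V t (J (G u)) := by rw [← map_smul, ← h2, hVl]
    have h4 : G u = 0 := by
      refine hbij.1 ?_
      rw [hN, map_zero, sub_eq_zero, ← map_smul, ← h3]
    rw [h3, h4, map_zero, map_zero, smul_zero]
  · obtain ⟨y, hy⟩ := hbij.2 (t • G (V t f))
    rw [hN, sub_eq_iff_eq_add, ← smul_add, ← map_add, ← map_add] at hy
    refine ⟨t • V t (f + J y), ?_⟩
    have h1 : T (t • V t (f + J y)) = V t (f + J y) - (f + J y) := by
      rw [map_smul]
      nth_rewrite 3 [← hVr (f + J y)]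
      abel
    have h2 : G (t • V t (f + J y)) = y := by rw [map_smul, ← hy]
    simp only [add_apply, ContinuousLinearMap.comp_apply, h1, h2,
      inv_smul_smul₀ ht0]
    abel

end IsolatedSpectrum

namespace DFLYGalerkin

variable {Bs Bw : Type*} [NormedAddCommGroup Bs] [NormedSpace ℂ Bs]
    [NormedAddCommGroup Bw] [NormedSpace ℂ Bw] (S : DFLYGalerkin Bs Bw) {μ : ℝ}

/-- L(1 - π_k) is bounded in the strong norm and small in the weak norm. First n makes the strong
contribution of L^n small relative to μ^{n+1}, then k compensates the fixed factor M^n. Thus L^{n+1}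
is a finite-rank perturbation of an operator of norm below μ^{n+1}. -/
lemma exists_norm_pow_sub_pow_comp_lt (haM : S.a < S.M) (haμ : S.a < μ) :
    ∃ n k, ‖S.L ^ (n + 1) - (S.L ^ (n + 1)).comp (S.πs k)‖ < μ ^ (n + 1) := by
  have ha := S.a_pos
  have hb := S.b_pos
  have hM := S.M_pos
  have hμ : 0 < μ := ha.trans haμ
  have hd : 0 < S.M - S.a := sub_pos.2 haM
  set N := 2 * (S.a + S.b * ‖S.emb‖) with hN
  have hN0 : 0 ≤ N := by positivity
  obtain ⟨n, hn⟩ := exists_pow_lt_of_lt_one (show 0 < μ / (2 * (N + 1)) by positivity)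
    ((div_lt_one hμ).2 haμ)
  have hn' : S.a ^ n * N ≤ μ ^ (n + 1) / 2 := by
    rw [div_pow, div_lt_iff₀ (by positivity), div_mul_eq_mul_div, lt_div_iff₀ (by positivity)] at hn
    have : 0 < S.a ^ n := by positivity
    rw [pow_succ]
    nlinarith
  have hlim : Tendsto (fun k ↦ S.b / (S.M - S.a) * (S.M ^ n * S.ε k)) atTop (𝓝 0) := by
    simpa using (S.ε_tendsto.const_mul (S.M ^ n)).const_mul (S.b / (S.M - S.a))
  obtain ⟨k, hk⟩ := (hlim.eventually_lt_const
    (show 0 < μ ^ (n + 1) / 4 by positivity)).exists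
  refine ⟨n, k, lt_of_le_of_lt (ContinuousLinearMap.opNorm_le_bound _
    (show 0 ≤ μ ^ (n + 1) * (3 / 4) by positivity) fun u ↦ ?_)
    (by nlinarith [pow_pos hμ (n + 1)])⟩
  set v := S.L (u - S.πs k u) with hv
  have h1 : (S.L ^ (n + 1) - (S.L ^ (n + 1)).comp (S.πs k)) u = (S.L ^ n) v := by
    rw [sub_apply, ContinuousLinearMap.comp_apply, ← map_sub, pow_succ]
    rfl
  have h2 : ‖v‖ ≤ N * ‖u‖ := by
    have h3 := S.isDFLY_L.norm_apply_le hb (u - S.πs k u)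
    have h4 : ‖S.πs k u‖ ≤ ‖u‖ := ((S.πs k).le_opNorm u).trans
      (mul_le_of_le_one_left (norm_nonneg _) (S.πs_norm k))
    have h5 : ‖u - S.πs k u‖ ≤ 2 * ‖u‖ := (norm_sub_le _ _).trans (by linarith)
    have h6 : 0 ≤ S.a + S.b * ‖S.emb‖ := by positivity
    calc ‖v‖ ≤ _ := h3
      _ ≤ (S.a + S.b * ‖S.emb‖) * (2 * ‖u‖) := by gcongr
      _ = _ := by rw [hN]; ring
  have h3 : ‖S.emb v‖ ≤ S.ε k * ‖u‖ := by
    refine ((S.emb.comp (S.L.comp (ContinuousLinearMap.id ℂ Bs - S.πs k))).le_opNorm u).trans ?_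
    gcongr
    exact (le_add_of_nonneg_left (norm_nonneg _)).trans (S.mixed_tail k)
  rw [h1]
  calc ‖(S.L ^ n) v‖ ≤ S.a ^ n * ‖v‖ + S.b / (S.M - S.a) * (S.M ^ n * ‖S.emb v‖) :=
        S.isDFLY_L.strong_pow ha hb haM n v
    _ ≤ S.a ^ n * (N * ‖u‖) + S.b / (S.M - S.a) * (S.M ^ n * (S.ε k * ‖u‖)) := by gcongr
    _ = (S.a ^ n * N + S.b / (S.M - S.a) * (S.M ^ n * S.ε k)) * ‖u‖ := by ring
    _ ≤ _ := by gcongr; linarith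

lemma eventually_mem_resolventSet [CompleteSpace Bs] (haM : S.a < S.M) (haμ : S.a < μ) {lam : ℂ}
    (hlam : μ < ‖lam‖) : ∀ᶠ z in 𝓝[≠] lam, z ∈ resolventSet ℂ S.L := by
  have hμ : 0 < μ := S.a_pos.trans haμ
  have hlam0 : lam ≠ 0 := norm_pos_iff.1 (hμ.trans hlam)
  obtain ⟨n, k, hnk⟩ := S.exists_norm_pow_sub_pow_comp_lt haM haμ
  set W := LinearMap.range (S.πs k : Bs →ₗ[ℂ] Bs)
  let G : Bs →L[ℂ] W := (S.πs k).codRestrict W fun x ↦ ⟨x, rfl⟩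
  have h1 : ‖((lam ^ (n + 1))⁻¹ : ℂ)‖ < (μ ^ (n + 1))⁻¹ := by
    rw [norm_inv, norm_pow]
    gcongr
  have h2 := eventually_inv_mem_resolventSet_add_comp _ G ((S.L ^ (n + 1)).comp W.subtypeL) hnk h1
  have h3 : S.L ^ (n + 1) - (S.L ^ (n + 1)).comp (S.πs k) +
      ((S.L ^ (n + 1)).comp W.subtypeL).comp G = S.L ^ (n + 1) :=
    sub_add_cancel _ _
  rw [h3] at h2
  -- The nonzero derivative keeps punctured neighbourhoods punctured; spectral mapping for powers
  -- then passes from L^{n+1} back to L.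
  have h4 : Tendsto (fun z : ℂ ↦ (z ^ (n + 1))⁻¹) (𝓝[≠] lam) (𝓝[≠] (lam ^ (n + 1))⁻¹) := by
    refine ((hasDerivAt_pow (n + 1) lam).inv (pow_ne_zero _ hlam0)).tendsto_nhdsNE ?_
    have : ((n + 1 : ℕ) : ℂ) ≠ 0 := Nat.cast_ne_zero.2 n.succ_ne_zero
    simpa [hlam0] using this
  have h5 : ∀ᶠ z in 𝓝[≠] lam, z ≠ 0 :=
    mem_nhdsWithin_of_mem_nhds (isOpen_ne.mem_nhds hlam0)
  filter_upwards [h4.eventually h2, h5] with z hz hz0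
  have hz' := hz (inv_ne_zero (pow_ne_zero _ hz0))
  rw [inv_inv] at hz'
  by_contra hcon
  exact (spectrum.pow_mem_pow S.L (n + 1) hcon) hz'

end DFLYGalerkin

/-! ### Discs as domains bounded by a piecewise C¹ cycle. -/

section Circle

open MeasureTheory

/-- The positively oriented circle as a closed piecewise `C¹` curve. -/
def circleLoop (c : ℂ) (r : ℝ) : PiecewiseC1Loop where
  toFun t := circleMap c r (2 * Real.pi * t)
  continuousOn := ((continuous_circleMap c r).comp (by fun_prop)).continuousOn
  closed := by
    have := periodic_circleMap c r 0
    simpa using this.symm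
  piecewise := by
    refine ⟨1, fun j ↦ j, by simp, by simp, by simp, fun j _ ↦ ?_⟩
    exact ((contDiff_circleMap c r).comp (contDiff_const.mul contDiff_id)).contDiffOn

lemma circleLoop_integral (c : ℂ) (r : ℝ) (f : ℂ → ℂ) :
    (circleLoop c r).integral f = ∮ z in C(c, r), f z := by
  have hd : ∀ t, deriv (circleLoop c r).toFun t =
      (2 * Real.pi) • deriv (circleMap c r) (2 * Real.pi * t) := fun t ↦ by
    have h1 := (hasDerivAt_circleMap c r (2 * Real.pi * t)).scomp t
      ((hasDerivAt_id t).const_mul (2 * Real.pi))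
    rw [(hasDerivAt_circleMap c r (2 * Real.pi * t)).deriv]
    rw [show (circleLoop c r).toFun = circleMap c r ∘ HMul.hMul (2 * Real.pi) from rfl]
    simpa using h1.deriv
  have h2 := intervalIntegral.smul_integral_comp_mul_left (a := 0) (b := 1)
    (fun θ ↦ deriv (circleMap c r) θ • f (circleMap c r θ)) (2 * Real.pi)
  rw [mul_zero, mul_one] at h2
  rw [circleIntegral, ← h2, ← intervalIntegral.integral_smul, PiecewiseC1Loop.integral]
  simp only [hd, smul_assoc]
  rfl

lemma trace_circleLoop (c : ℂ) {r : ℝ} (hr : 0 ≤ r) : (circleLoop c r).trace = Metric.sphere c r := by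
  have h : (circleLoop c r).trace =
      circleMap c r '' ((fun t ↦ 2 * Real.pi * t) '' Set.Icc (0 : ℝ) 1) := by
    rw [Set.image_image]; rfl
  have h2 : (fun t ↦ 2 * Real.pi * t) '' Set.Icc (0 : ℝ) 1 = Set.Icc 0 (2 * Real.pi) := by
    rw [Set.image_mul_left_Icc' Real.two_pi_pos]
    simp
  rw [h, h2]
  refine (Set.image_subset_range _ _).antisymm ?_ |>.trans ?_
  · rintro _ ⟨θ, rfl⟩
    obtain ⟨y, hy, hyθ⟩ := (periodic_circleMap c r).exists_mem_Ico₀ Real.two_pi_pos θ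
    exact ⟨y, Set.Ico_subset_Icc_self hy, hyθ.symm⟩
  · rw [range_circleMap, abs_of_nonneg hr]

lemma isPiecewiseC1Domain_ball (c : ℂ) {r : ℝ} (hr : 0 < r) :
    IsPiecewiseC1Domain (Metric.ball c r) (fun _ : Fin 1 ↦ circleLoop c r) where
  isOpen := Metric.isOpen_ball
  isConnected := (convex_ball c r).isConnected (Metric.nonempty_ball.2 hr)
  isBounded := Metric.isBounded_ball
  frontier_eq := by
    rw [frontier_ball c hr.ne', Set.iUnion_const, trace_circleLoop c hr.le]
  winding_inside w hw := by
    simp only [cycleWinding, cycleIntegral, Finset.univ_unique, Finset.sum_singleton,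
      circleLoop_integral, circleIntegral.integral_sub_inv_of_mem_ball hw]
    exact inv_mul_cancel₀ Complex.two_pi_I_ne_zero
  winding_outside w hw := by
    rw [closure_ball c hr.ne'] at hw
    have hne : ∀ z ∈ Metric.closedBall c r, z - w ≠ 0 := fun z hz h ↦
      hw (sub_eq_zero.1 h ▸ hz)
    have : (∮ z in C(c, r), (z - w)⁻¹) = 0 :=
      Complex.circleIntegral_eq_zero_of_differentiable_on_off_countable hr.le
        Set.countable_empty (ContinuousOn.inv₀ (by fun_prop) hne) fun z hz ↦
          DifferentiableAt.inv (by fun_prop) (hne z (Metric.ball_subset_closedBall hz.1))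
    simp [cycleWinding, cycleIntegral, circleLoop_integral, this]

end Circle

/-! ### Approximation of eigenvalues and eigenvectors. -/

namespace DFLYGalerkin

open Module.End

variable {Bs Bw : Type*} [NormedAddCommGroup Bs] [NormedSpace ℂ Bs] [CompleteSpace Bs]
    [NormedAddCommGroup Bw] [NormedSpace ℂ Bw] [CompleteSpace Bw] (S : DFLYGalerkin Bs Bw)
    {μ : ℝ} {lam : ℂ}

omit [CompleteSpace Bw] in
lemma exists_isolating_circle (haM : S.a < S.M) (haμ : S.a < μ) (hlam : μ < ‖lam‖) {ε : ℝ}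
    (hε : 0 < ε) : ∃ (r : ℝ) (C : Fin 1 → PiecewiseC1Loop), 0 < r ∧ r < ε ∧
      IsPiecewiseC1Domain (Metric.ball lam r) C ∧ (∀ z ∈ Metric.closedBall lam r, μ ≤ ‖z‖) ∧
      cycleTrace C = Metric.sphere lam r ∧ cycleTrace C ⊆ resolventSet ℂ S.L := by
  obtain ⟨r₀, hr₀, hsub⟩ := Metric.mem_nhdsWithin_iff.1 (S.eventually_mem_resolventSet haM haμ hlam)
  have hd : 0 < ‖lam‖ - μ := sub_pos.2 hlam
  obtain ⟨r, hr, hrlt⟩ := exists_between (lt_min hε (lt_min hr₀ hd))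
  have h1 : r < ε := hrlt.trans_le (min_le_left _ _)
  have h2 : r < r₀ := hrlt.trans_le ((min_le_right _ _).trans (min_le_left _ _))
  have h3 : r < ‖lam‖ - μ := hrlt.trans_le ((min_le_right _ _).trans (min_le_right _ _))
  have hdom := isPiecewiseC1Domain_ball lam hr
  have htr := hdom.cycleTrace_eq.trans (frontier_ball lam hr.ne')
  refine ⟨r, _, hr, h1, hdom, fun z hz ↦ ?_, htr, fun z hz ↦ hsub ?_⟩
  · have := norm_sub_norm_le lam z
    rw [Metric.mem_closedBall, dist_comm, dist_eq_norm] at hz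
    linarith
  · rw [htr] at hz
    refine ⟨Metric.mem_ball.2 ((Metric.mem_sphere.1 hz).trans_lt h2), ?_⟩
    rintro rfl
    simp at hz
    exact hr.ne hz

/-- Take v to be the Riesz projection of u for L_k over a circle isolating λ. It lies in the
generalized eigenspaces inside the disc and tends weakly to the projection for L, which fixes u. -/
lemma eventually_exists_mem_iSup_maxGenEigenspace (haμ : S.a < μ) (hμM : μ < S.M)
    (hlam : μ < ‖lam‖) {u : Bs} (hu : HasEigenvector (S.L : Bs →ₗ[ℂ] Bs) lam u) {ε : ℝ}
    (hε : 0 < ε) : ∀ᶠ k in atTop, ∃ v ∈ ⨆ ν ∈ Metric.ball lam ε,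
      maxGenEigenspace (S.Lk k : Bs →ₗ[ℂ] Bs) ν, ‖S.emb v - S.emb u‖ < ε := by
  obtain ⟨r, C, hr, hrε, hdom, hμ, htr, hCL⟩ :=
    S.exists_isolating_circle (haμ.trans hμM) haμ hlam hε
  have hμC : ∀ z ∈ cycleTrace C, μ ≤ ‖z‖ := fun z hz ↦
    hμ z (Metric.sphere_subset_closedBall (htr ▸ hz))
  obtain ⟨K, -, -, hK⟩ :=
    S.exists_uniform_resolvent_bound haμ hμM (isCompact_cycleTrace C) hμC hCL
  have hlim := S.tendsto_emb_apply (S.tendsto_normSW_rieszProjector_sub haμ hμM hμC hCL) u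
  have hlamC : lam ∉ cycleTrace C := by rw [htr]; simpa using hr.ne
  have hPu : rieszProjector C S.L u = u := by
    rw [rieszProjector_apply_of_genEigen hCL hlamC 1 u, hdom.winding_inside lam
      (Metric.mem_ball_self hr), one_smul]
    have : S.L u = lam • u := hu.apply_eq_smul
    simp [this]
  rw [hPu] at hlim
  filter_upwards [hK, Metric.tendsto_nhds.1 hlim ε hε] with k hk hkε
  refine ⟨_, ?_, (dist_eq_norm _ _).symm.trans_lt hkε⟩
  refine rieszProjector_mem_iSup hk.1 (fun c hc hcs ↦ ?_) (S.iSup_maxGenEigenspace_Lk k) u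
  exact hdom.cycleWinding_eq_zero hc fun hcr ↦ hcs (Metric.ball_subset_ball hrε.le hcr)

lemma eventually_exists_hasEigenvalue (haμ : S.a < μ) (hμM : μ < S.M)
    (hlam : μ < ‖lam‖) (hL : HasEigenvalue (S.L : Bs →ₗ[ℂ] Bs) lam) {ε : ℝ} (hε : 0 < ε) :
    ∀ᶠ k in atTop, ∃ ν, HasEigenvalue (S.Lk k : Bs →ₗ[ℂ] Bs) ν ∧ ‖ν - lam‖ < ε := by
  obtain ⟨u, hu⟩ := hL.exists_hasEigenvector
  have hpos : 0 < ‖S.emb u‖ := norm_pos_iff.2 (S.emb_ne_zero hu.2)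
  -- Precision ‖emb u‖ rules out v = 0, so the disc must contain an eigenvalue.
  filter_upwards [S.eventually_exists_mem_iSup_maxGenEigenspace haμ hμM hlam hu
    (lt_min hε hpos)] with k ⟨v, hv, hvu⟩
  by_contra! hcon
  have hbot : ⨆ ν ∈ Metric.ball lam (min ε ‖S.emb u‖),
      maxGenEigenspace (S.Lk k : Bs →ₗ[ℂ] Bs) ν = ⊥ := by
    refine iSup₂_eq_bot.2 fun ν hν ↦ ?_
    by_contra hne
    have h1 : HasEigenvalue (S.Lk k : Bs →ₗ[ℂ] Bs) ν := HasUnifEigenvalue.lt zero_lt_one hne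
    refine absurd (hcon ν h1) (not_le.2 ?_)
    rw [← dist_eq_norm]
    exact (Metric.mem_ball.1 hν).trans_le (min_le_left _ _)
  rw [hbot, Submodule.mem_bot] at hv
  rw [hv, map_zero, zero_sub, norm_neg] at hvu
  exact absurd (hvu.trans_le (min_le_right _ _)) (lt_irrefl _)

omit [CompleteSpace Bs] [CompleteSpace Bw] in
lemma norm_le_of_hasEigenvector (haμ : S.a < μ) {k : ℕ} {ν : ℂ} (hν : μ ≤ ‖ν‖) {v : Bs}
    (hv : S.Lk k v = ν • v) : ‖v‖ ≤ S.b / (μ - S.a) * ‖S.emb v‖ := by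
  have h1 := (S.isDFLY_Lk k).sub_mul_norm_le ν v
  rw [hv, sub_self, norm_zero, zero_add] at h1
  have h2 : (μ - S.a) * ‖v‖ ≤ (‖ν‖ - S.a) * ‖v‖ :=
    mul_le_mul_of_nonneg_right (by linarith) (norm_nonneg _)
  rw [div_mul_eq_mul_div, le_div_iff₀ (sub_pos.2 haμ)]
  linarith

/-- The v_j are eventually strongly bounded by DFLY and fixed by the projectors of their own L_k, so
v_j - P v_j tends weakly to 0. Since P has finite rank, P v_j has a convergent subsequence. -/
lemma exists_hasEigenvector_near (haμ : S.a < μ) (hμM : μ < S.M)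
    (hlam : μ < ‖lam‖) {κ : ℕ → ℕ} (hκ : Tendsto κ atTop atTop) {ν : ℕ → ℂ}
    (hν : Tendsto ν atTop (𝓝 lam)) {v : ℕ → Bs} (hv : ∀ j, S.Lk (κ j) (v j) = ν j • v j)
    (hv1 : ∀ j, ‖S.emb (v j)‖ = 1) :
    ∃ u, HasEigenvector (S.L : Bs →ₗ[ℂ] Bs) lam u ∧ ‖S.emb u‖ = 1 ∧
      ∃ ψ : ℕ → ℕ, StrictMono ψ ∧ Tendsto (fun j ↦ S.emb (v (ψ j))) atTop (𝓝 (S.emb u)) := by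
  obtain ⟨r, C, hr, -, hdom, hμ, htr, hCL⟩ :=
    S.exists_isolating_circle (haμ.trans hμM) haμ hlam one_pos
  have hμC : ∀ z ∈ cycleTrace C, μ ≤ ‖z‖ := fun z hz ↦
    hμ z (Metric.sphere_subset_closedBall (htr ▸ hz))
  have h0 : cycleWinding C 0 = 0 := by
    have h0' : (0 : ℂ) ∉ Metric.closedBall lam r := fun h ↦ by
      have := hμ 0 h
      rw [norm_zero] at this
      linarith [S.a_pos]
    refine hdom.cycleWinding_eq_zero (fun h ↦ h0' ?_) fun h ↦ h0' (Metric.ball_subset_closedBall h)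
    exact Metric.sphere_subset_closedBall (htr ▸ h)
  obtain ⟨K, hK0, hKL, hK⟩ :=
    S.exists_uniform_resolvent_bound haμ hμM (isCompact_cycleTrace C) hμC hCL
  obtain ⟨D, -, hD⟩ := IsDFLY.exists_norm_le_of_winding S.emb S.a_pos S.b_pos haμ hμM C hμC hK0
  have hP := S.tendsto_normSW_rieszProjector_sub haμ hμM hμC hCL
  set P := rieszProjector C S.L
  have hidem : ∀ u, P (P u) = P u :=
    S.rieszProjector_idempotent haμ hμM hμC hCL fun c hc ↦ hdom.cycleWinding_eq hc
  have hfin : FiniteDimensional ℂ (LinearMap.range (P : Bs →ₗ[ℂ] Bs)) :=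
    finiteDimensional_range_of_norm_le S.emb_compact hidem (D := D) fun u hu ↦
      hD S.L S.isDFLY_L hCL hKL u (by rw [h0, zero_smul, sub_zero]; exact congrArg _ hu.symm)
  have hnear : ∀ᶠ j in atTop, ν j ∈ Metric.ball lam r := hν (Metric.ball_mem_nhds lam hr)
  have hvbd : ∀ᶠ j in atTop, ‖v j‖ ≤ S.b / (μ - S.a) := by
    filter_upwards [hnear] with j hj
    simpa [hv1] using S.norm_le_of_hasEigenvector haμ (hμ _ (Metric.ball_subset_closedBall hj)) (hv j)
  set B := S.b / (μ - S.a) with hB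
  have hPv : Tendsto (fun j ↦ S.emb (v j) - S.emb (P (v j))) atTop (𝓝 0) := by
    have h1 : Tendsto (fun j ↦ S.normSW (rieszProjector C (S.Lk (κ j)) - P) * B) atTop (𝓝 0) := by
      simpa using (hP.comp hκ).mul_const B
    refine squeeze_zero_norm' ?_ h1
    filter_upwards [hnear, hvbd, hκ.eventually hK] with j hj hjB hjK
    have hνC : ν j ∉ cycleTrace C := by
      rw [htr]
      exact fun h ↦ (Metric.mem_ball.1 hj).ne (Metric.mem_sphere.1 h)
    have hQ : rieszProjector C (S.Lk (κ j)) (v j) = v j := by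
      rw [rieszProjector_apply_of_genEigen hjK.1 hνC 1 (v j) (by simp [hv]),
        hdom.winding_inside _ hj, one_smul]
    rw [← map_sub]
    nth_rewrite 1 [← hQ]
    exact (S.norm_emb_le_normSW (rieszProjector C (S.Lk (κ j)) - P) (v j)).trans
      (mul_le_mul_of_nonneg_left hjB (norm_nonneg _))
  let w : ℕ → LinearMap.range (P : Bs →ₗ[ℂ] Bs) := fun j ↦ ⟨P (v j), v j, rfl⟩
  have := FiniteDimensional.proper ℂ (LinearMap.range (P : Bs →ₗ[ℂ] Bs))
  obtain ⟨u, -, ψ, hψ, hlim⟩ := tendsto_subseq_of_frequently_bounded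
    (Metric.isBounded_closedBall (x := (0 : LinearMap.range (P : Bs →ₗ[ℂ] Bs)))
      (r := ‖P‖ * B)) (x := w) <| Eventually.frequently <| by
        filter_upwards [hvbd] with j hj
        rw [mem_closedBall_zero_iff]
        exact (P.le_opNorm _).trans (mul_le_mul_of_nonneg_left hj (norm_nonneg _))
  have hlimv : Tendsto (fun j ↦ S.emb (v (ψ j))) atTop (𝓝 (S.emb (u : Bs))) := by
    have h1 := ((S.emb.continuous.comp continuous_subtype_val).tendsto u).comp hlim
    have h2 := (hPv.comp hψ.tendsto_atTop).add h1
    rw [zero_add] at h2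
    refine h2.congr fun j ↦ ?_
    simp [w]
  have hnorm : ‖S.emb (u : Bs)‖ = 1 :=
    tendsto_nhds_unique hlimv.norm (by simp only [hv1]; exact tendsto_const_nhds)
  have heig : S.L (u : Bs) = lam • (u : Bs) := by
    refine S.emb_injective ?_
    -- The v_j converge in the weak norm only, so the eigenvalue equation is passed to the limit
    -- through the weak extension of L.
    rw [← S.Lw_emb, map_smul]
    have h1 := (S.Lw.continuous.tendsto _).comp hlimv
    have h2 := (hν.comp hψ.tendsto_atTop).smul hlimv
    have h3 : Tendsto (fun j ↦ S.emb (S.Lk (κ (ψ j)) (v (ψ j)) - S.L (v (ψ j)))) atTop (𝓝 0) := by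
      have h4 : Tendsto (fun j ↦ S.δ (κ (ψ j)) * B) atTop (𝓝 0) := by
        simpa using ((S.tendsto_δ.comp hκ).comp hψ.tendsto_atTop).mul_const B
      refine squeeze_zero_norm' ?_ h4
      filter_upwards [hψ.tendsto_atTop.eventually hvbd] with j hj
      exact (S.norm_emb_Lk_sub_L_le _ _).trans (mul_le_mul_of_nonneg_left hj (S.δ_nonneg _))
    have h5 := h1.add h3
    rw [add_zero] at h5
    refine tendsto_nhds_unique h5 (h2.congr fun j ↦ ?_)
    simp [hv, S.Lw_emb]
  refine ⟨u, hasEigenvector_iff.2 ⟨mem_eigenspace_iff.2 heig, fun h ↦ ?_⟩, hnorm, ψ, hψ, hlimv⟩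
  rw [h, map_zero, norm_zero] at hnorm
  exact zero_ne_one hnorm

/-- Otherwise bad indices k are cofinal; choosing eigenvalues of L_k within 1/(j+1) of λ along them
and normalizing eigenvectors contradicts `exists_hasEigenvector_near`. -/
lemma eventually_exists_hasEigenvector (haμ : S.a < μ) (hμM : μ < S.M)
    (hlam : μ < ‖lam‖) (hL : HasEigenvalue (S.L : Bs →ₗ[ℂ] Bs) lam) {ε : ℝ} (hε : 0 < ε) :
    ∀ᶠ k in atTop, ∃ (ν : ℂ) (v u : Bs), HasEigenvector (S.Lk k : Bs →ₗ[ℂ] Bs) ν v ∧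
      HasEigenvector (S.L : Bs →ₗ[ℂ] Bs) lam u ∧
      ‖ν - lam‖ < ε ∧ ‖S.emb u‖ = 1 ∧ ‖S.emb v - S.emb u‖ < ε := by
  by_contra hcon
  rw [not_eventually] at hcon
  have hchoose : ∀ j : ℕ, ∃ (k : ℕ) (ν : ℂ) (v : Bs), j ≤ k ∧
      HasEigenvector (S.Lk k : Bs →ₗ[ℂ] Bs) ν v ∧ ‖ν - lam‖ < 1 / ((j : ℝ) + 1) ∧
      ‖S.emb v‖ = 1 ∧ ¬ ∃ (ν : ℂ) (v u : Bs), HasEigenvector (S.Lk k : Bs →ₗ[ℂ] Bs) ν v ∧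
        HasEigenvector (S.L : Bs →ₗ[ℂ] Bs) lam u ∧
        ‖ν - lam‖ < ε ∧ ‖S.emb u‖ = 1 ∧ ‖S.emb v - S.emb u‖ < ε := by
    intro j
    obtain ⟨k, hbad, ⟨ν, hν, hνj⟩, hjk⟩ := (hcon.and_eventually
      ((S.eventually_exists_hasEigenvalue haμ hμM hlam hL
        (show 0 < 1 / ((j : ℝ) + 1) by positivity)).and (eventually_ge_atTop j))).exists
    obtain ⟨v, hv⟩ := hν.exists_hasEigenvector
    have hpos : ‖S.emb v‖ ≠ 0 := norm_ne_zero_iff.2 (S.emb_ne_zero hv.2)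
    refine ⟨k, ν, (‖S.emb v‖⁻¹ : ℂ) • v, hjk, ⟨Submodule.smul_mem _ _ hv.1, ?_⟩, hνj, ?_, hbad⟩
    · exact smul_ne_zero (inv_ne_zero (by exact_mod_cast hpos)) hv.2
    · rw [map_smul, norm_smul, norm_inv, Complex.norm_real, norm_norm, inv_mul_cancel₀ hpos]
  choose κ ν v hκ hv hνj hv1 hbad using hchoose
  have hκ' : Tendsto κ atTop atTop := tendsto_atTop_mono hκ tendsto_id
  have hν' : Tendsto ν atTop (𝓝 lam) := by
    rw [tendsto_iff_norm_sub_tendsto_zero]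
    exact squeeze_zero (fun _ ↦ norm_nonneg _) (fun j ↦ (hνj j).le)
      tendsto_one_div_add_atTop_nhds_zero_nat
  obtain ⟨u, hu, hu1, ψ, hψ, hlim⟩ := S.exists_hasEigenvector_near haμ hμM hlam hκ' hν'
    (fun j ↦ (hv j).apply_eq_smul) hv1
  obtain ⟨j, hj1, hj2⟩ := ((Metric.tendsto_nhds.1 hlim ε hε).and
    (hψ.tendsto_atTop.eventually (Metric.tendsto_nhds.1 hν' ε hε))).exists
  rw [dist_eq_norm] at hj1 hj2
  exact hbad (ψ j) ⟨ν (ψ j), v (ψ j), u, hv (ψ j), hu, hj2, hu1, hj1⟩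

end DFLYGalerkin

theorem theoremA10 {Bs Bw : Type*} [NormedAddCommGroup Bs] [NormedSpace ℂ Bs] [CompleteSpace Bs]
    [NormedAddCommGroup Bw] [NormedSpace ℂ Bw] [CompleteSpace Bw]
    (S : DFLYGalerkin Bs Bw) (haM : S.a < S.M) (μ : ℝ) (hμ : μ ∈ Set.Ioo S.a S.M)
    (hrate : Tendsto (fun k => S.δ k * S.normEquiv k ^ S.exponent μ) atTop (𝓝 0)) :
    -- spectral windows
    (∀ (U : Set ℂ) (n : ℕ) (C : Fin n → PiecewiseC1Loop), IsPiecewiseC1Domain U C →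
      (∀ z ∈ frontier U, μ ≤ ‖z‖) → frontier U ⊆ resolventSet ℂ S.L →
      (∃ k₀ : ℕ, ∀ k ≥ k₀,
        (frontier U ⊆ resolventSet ℂ (S.Lk k) ∧ frontier U ⊆ resolventSet ℂ (S.LkWeak k) ∧
          (⨆ z ∈ frontier U, ENNReal.ofReal (S.b * S.δ k) * resolventNorm (S.LkWeak k) z) <
            ⨅ z ∈ frontier U, ENNReal.ofReal (‖z‖ - S.a)) ∧
        Module.rank ℂ (LinearMap.range (rieszProjector C (S.Lk k) : Bs →ₗ[ℂ] Bs)) =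
          Module.rank ℂ (LinearMap.range (rieszProjector C S.L : Bs →ₗ[ℂ] Bs))) ∧
      Tendsto (fun k => S.normSW (rieszProjector C (S.Lk k) - rieszProjector C S.L))
        atTop (𝓝 0)) ∧
    -- eigenvalues and eigenvectors
    (∀ lam : ℂ, μ < ‖lam‖ → Module.End.HasEigenvalue (S.L : Bs →ₗ[ℂ] Bs) lam →
      ∀ ε > 0, ∃ k₀ : ℕ, ∀ k ≥ k₀,
        (∃ (ν : ℂ) (v u : Bs), Module.End.HasEigenvector (S.Lk k : Bs →ₗ[ℂ] Bs) ν v ∧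
          Module.End.HasEigenvector (S.L : Bs →ₗ[ℂ] Bs) lam u ∧
          ‖ν - lam‖ < ε ∧ ‖S.emb u‖ = 1 ∧ ‖S.emb v - S.emb u‖ < ε)) ∧
    (∀ (lam : ℂ) (u : Bs), μ < ‖lam‖ → Module.End.HasEigenvector (S.L : Bs →ₗ[ℂ] Bs) lam u →
      ∀ ε > 0, ∃ k₀ : ℕ, ∀ k ≥ k₀,
        ∃ v ∈ ⨆ ν ∈ Metric.ball lam ε,
            Module.End.maxGenEigenspace (S.Lk k : Bs →ₗ[ℂ] Bs) ν,
          ‖S.emb v - S.emb u‖ < ε) := by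
  obtain ⟨haμ, hμM⟩ := hμ
  refine ⟨fun U n C hU hμU hUL ↦ ?_, fun lam hlam hL ε hε ↦ ?_, fun lam u hlam hu ε hε ↦ ?_⟩
  · have hμC : ∀ z ∈ cycleTrace C, μ ≤ ‖z‖ := hU.cycleTrace_eq ▸ hμU
    have hCL : cycleTrace C ⊆ resolventSet ℂ S.L := hU.cycleTrace_eq ▸ hUL
    have hcpt : IsCompact (frontier U) := hU.cycleTrace_eq ▸ isCompact_cycleTrace C
    exact ⟨eventually_atTop.1 ((S.eventually_spectral_window haμ hμM hrate hcpt hμU hUL).and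
      (S.eventually_rank_range_rieszProjector_eq haμ hμM hμC hCL fun c hc ↦ hU.cycleWinding_eq hc)),
      S.tendsto_normSW_rieszProjector_sub haμ hμM hμC hCL⟩
  · exact eventually_atTop.1 (S.eventually_exists_hasEigenvector haμ hμM hlam hL hε)
  · exact eventually_atTop.1
      (S.eventually_exists_mem_iSup_maxGenEigenspace haμ hμM hlam hu hε)

end
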